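/- Let $n\ge 0$ be an integer, let $T\subseteq\mathbb R$ be a nonempty open interval, let $I\subseteq\mathbb R$ be an interval, and let $F:I\to\mathbb R$ be twice differentiable (one-sided derivatives at endpoints belonging to $I$), with $f=F'$. By an *admissible family* we mean a real-analytic family $H=H(\tau)$, $\tau\in T$, of complex hermitian $n\times n$ matrices whose spectra are all contained in $I$. Dots denote derivatives in $\tau$, $g(H)$ is the functional calculus, $[A,B]=AB-BA$, and $\mathrm{Tr}$ is the trace. For every admissible family $H$ the function $\tau\mapsto \mathrm{Tr}\,F(H)$ is twice differentiable on $T$, and near each $\tau_0\in T$ the eigenvalues of $H(\tau)$, repeated according to multiplicity, can be labelled $\lambda_1(\tau),\dots,\lambda_n(\tau)$ with every $\lambda_j$ analytic at $\tau_0$. The following hold. 1. Suppose that $F$ is convex (respectively concave) on $I$. Then for every admissible family $H$, every $\tau_0\in T$ and every labelling as above, at $\tau=\tau_0$, $$\frac{d^2}{d\tau^2}\mathrm{Tr}\,F(H)\ \ge\ (\text{respectively}\le)\ \ \mathrm{Tr}\big(f(H)\ddot H\big)+\sum_{j=1}^n f'(\lambda_j)\dot\lambda_j^2 ,$$ with equality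 (for all admissible families, all $\tau_0$ and all labellings) if $F$ is affine on $I$. In particular, if $\ddot H=0$ on $T$, then $\mathrm{Tr}\,F(H)$ is convex (respectively concave) in $\tau\in T$. 2. Suppose that $f'=F''$ is convex (respectively concave) on $I$. Then for every admissible family $H$ and every $\tau\in T$, $$\frac{d^2}{d\tau^2}\mathrm{Tr}\,F(H)\ \le\ (\text{respectively}\ge)\ \ \mathrm{Tr}\big(f(H)\ddot H\big)+\mathrm{Tr}\big(\dot H f'(H)\dot H\big).$$ If $F$ coincides on $I$ with a polynomial of degree at most $3$, then equality holds for every admissible family and every $\tau\in T$. Conversely, if $n\ge2$ and equality holds for every admissible family and every $\tau\in T$, then $F$ coincides on $I$ with a polynomial of degree at most $3$. 3. Suppose that $F$ is of class $C^4$ on $I$ and that $F''''=f'''$ is convex (respectively concave) on $I$. Then for every admissible family $H$ and every $\tau\in T$, $$\frac{d^2}{d\tau^2}\mathrm{Tr}\,F(H)\ \ge\ (\text{respectively}\le)\ \ \mathrm{Tr}\big(f(H)\ddot H\big)+\mathrm{Tr}\big(\dot H f'(H)\dot H\big)+\frac1{12}\mathrm{Tr}\big(f'''(H)[H,\dot H]^2\big).$$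 If $F$ coincides on $I$ with a polynomial of degree at most $5$, then equality holds for every admissible family and every $\tau\in T$. Conversely, if $n\ge2$ and equality holds for every admissible family and every $\tau\in T$, then $F$ coincides on $I$ with a polynomial of degree at most $5$. -/

import Mathlib

open scoped Topology
open Polynomial (X C)

/-- The entrywise derivative of a one-parameter family of complex matrices. -/
noncomputable def matDeriv {n : ℕ} (H : ℝ → Matrix (Fin n) (Fin n) ℂ) (τ : ℝ) :
    Matrix (Fin n) (Fin n) ℂ :=
  Matrix.of fun i j => deriv (fun t => H t i j) τ

/-- `H` is a real-analytic family of hermitian matrices with parameter in `T`, all of whose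
spectra lie in `I`. Values of `H` outside of `T` are irrelevant. -/
structure IsAnalyticHermitianFamily {n : ℕ} (T I : Set ℝ)
    (H : ℝ → Matrix (Fin n) (Fin n) ℂ) : Prop where
  analytic : ∀ i j, AnalyticOnNhd ℝ (fun t => H t i j) T
  hermitian : ∀ τ ∈ T, (H τ).IsHermitian
  spectrum_subset : ∀ τ ∈ T, spectrum ℝ (H τ) ⊆ I

/-- `ev 0, …, ev (n - 1)` are functions, analytic at `τ`, which for every parameter near `τ` list
the eigenvalues of `H`, repeated according to multiplicity. -/
structure IsAnalyticEigenvalueLabelling {n : ℕ} (H : ℝ → Matrix (Fin n) (Fin n) ℂ) (τ : ℝ)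
    (ev : Fin n → ℝ → ℝ) : Prop where
  analytic : ∀ j, AnalyticAt ℝ (ev j) τ
  charpoly_eq : ∀ᶠ t in 𝓝 τ, (H t).charpoly = ∏ j, (X - C (ev j t : ℂ))

/-- The function `τ ↦ Tr F(H(τ))`, where `F(H(τ))` is given by the functional calculus.
For hermitian `H(τ)` this trace is real. -/
noncomputable def traceFun {n : ℕ} (F : ℝ → ℝ) (H : ℝ → Matrix (Fin n) (Fin n) ℂ) (τ : ℝ) : ℝ :=
  (cfc F (H τ)).trace.re

/-! ### Analytic eigenvalues of analytic hermitian families. -/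

section Rellich
open scoped Matrix.Norms.Operator ContDiff
open Matrix

/-! Everything rests on one formula. Write b_jk for the entries of Ḣ in an orthonormal eigenbasis of
H, and f[x,y] for the divided difference of f, with f[x,x] = f'(x). Then (Tr F(H))'' = Tr(f(H)Ḧ) +
Σ_{j,k} |b_jk|² f[λ_j,λ_k]. Every other term in the theorem is a sum with the same weights |b_jk|²,
so each claim becomes a claim about a scalar kernel on I × I.

Formula: since F is only twice differentiable, the chain rule is applied along analytic eigenvalues
(`Matrix.hasAnalyticEigenvaluesAt`), which gives Σ f'(λ)λ̇² + f(λ)λ̈. Rewriting this sum by matrix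
entries (`sum_deriv2_eq`) involves only the values of f and f' at finitely many points. Hermite
interpolation therefore reduces it to powers, where it follows by differentiating Tr H^(m+1) twice.

Inequalities: in statement 1 the kernel left over is f[x,y] off the diagonal, whose sign is given by
the monotonicity of f. In statement 2, Tr(Ḣ f'(H) Ḣ) has kernel (f'(x)+f'(y))/2, and the comparison
is the error of the trapezoidal rule for f'. In statement 3 the commutator term has kernel
-(x-y)²(f'''(x)+f'''(y))/2, and its twelfth is the end correction of that rule.

Converses: a rotating family with spectrum {x, y} (`eq_zero_of_forall_family`) forces the kernel to
vanish at (x, y). The resulting functional equations have only polynomial solutions. -/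

theorem Matrix.analyticAt_iff_entries {ι : Type*} [Fintype ι] [DecidableEq ι]
    {H : ℝ → Matrix ι ι ℂ} {t₀ : ℝ} :
    AnalyticAt ℝ H t₀ ↔ ∀ i j, AnalyticAt ℝ (fun t => H t i j) t₀ := by
  constructor
  · intro h i j
    exact ((entryLinearMap ℝ ℂ i j).toContinuousLinearMap.analyticAt _).comp h
  · intro h
    have : H = fun t => ∑ i, ∑ j, Matrix.single i j (H t i j) := by
      funext t; exact matrix_eq_sum_single (H t)
    rw [this]
    refine Finset.analyticAt_fun_sum _ fun i _ => Finset.analyticAt_fun_sum _ fun j _ => ?_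
    exact ((singleLinearMap ℝ i j).toContinuousLinearMap.analyticAt _).comp (h i j)

theorem AnalyticAt.matrix_trace {ι : Type*} [Fintype ι] [DecidableEq ι]
    {H : ℝ → Matrix ι ι ℂ} {t₀ : ℝ} (h : AnalyticAt ℝ H t₀) :
    AnalyticAt ℝ (fun t => (H t).trace) t₀ :=
  ((traceLinearMap ι ℝ ℂ).toContinuousLinearMap.analyticAt _).comp h

/-- The case b = 0 matters: the scaling factor used later is (t - t₀)^k, which may vanish at t₀. -/
theorem Matrix.charpoly_smul_one_add_smul {ι : Type*} [Fintype ι] [DecidableEq ι]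
    {K : Matrix ι ι ℂ} {e : ι → ℂ} (hK : K.charpoly = ∏ j, (X - C (e j))) (a b : ℂ) :
    (a • (1 : Matrix ι ι ℂ) + b • K).charpoly = ∏ j, (X - C (a + b * e j)) := by
  refine Polynomial.funext fun x => ?_
  have hdet : ∀ y : ℂ, (scalar ι y - K).det = ∏ j, (y - e j) := by
    intro y
    rw [← eval_charpoly, hK, Polynomial.eval_prod]; simp
  rw [eval_charpoly, Polynomial.eval_prod]
  simp only [Polynomial.eval_sub, Polynomial.eval_X, Polynomial.eval_C]
  by_cases hb : b = 0
  · subst hb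
    simp [← sub_smul, scalar_apply, ← smul_one_eq_diagonal]
  · have : scalar ι x - (a • (1 : Matrix ι ι ℂ) + b • K) = b • (scalar ι ((x - a) / b) - K) := by
      ext i j
      by_cases hij : i = j
      · subst hij; simp; field_simp; ring
      · simp [hij]
    rw [this, det_smul, hdet, ← Finset.card_univ, ← Finset.prod_const, ← Finset.prod_mul_distrib]
    refine Finset.prod_congr rfl fun j _ => ?_
    field_simp; ring

/-- The linear map which sends `(M, Z)` to the matrix with the entries of `M` in the block with
rows in `p` and columns outside of `p`, and with the entries of `Z` elsewhere. -/
noncomputable def blockMask {ι : Type*} [Fintype ι] [DecidableEq ι] (p : ι → Prop)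
    [DecidablePred p] : (Matrix ι ι ℂ × Matrix ι ι ℂ) →L[ℝ] Matrix ι ι ℂ :=
  LinearMap.toContinuousLinearMap
  { toFun := fun M => Matrix.of fun i j => if p i ∧ ¬ p j then M.1 i j else M.2 i j
    map_add' := fun M N => by ext i j; by_cases h : p i ∧ ¬ p j <;> simp [h]
    map_smul' := fun c M => by ext i j; by_cases h : p i ∧ ¬ p j <;> simp [h] }

theorem blockMask_apply {ι : Type*} [Fintype ι] [DecidableEq ι] (p : ι → Prop)
    [DecidablePred p] (M : Matrix ι ι ℂ × Matrix ι ι ℂ) (i j : ι) :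
    blockMask p M i j = if p i ∧ ¬ p j then M.1 i j else M.2 i j := rfl

/-- Conjugate transposition of complex matrices as a continuous real-linear map. -/
noncomputable def conjTransposeL (ι : Type*) [Fintype ι] [DecidableEq ι] :
    Matrix ι ι ℂ →L[ℝ] Matrix ι ι ℂ :=
  LinearMap.toContinuousLinearMap
  { toFun := fun M => Mᴴ
    map_add' := fun M N => conjTranspose_add M N
    map_smul' := fun c M => by simp [conjTranspose_smul] }

theorem AnalyticAt.matrix_conjTranspose {ι : Type*} [Fintype ι] [DecidableEq ι]
    {H : ℝ → Matrix ι ι ℂ} {t₀ : ℝ} (h : AnalyticAt ℝ H t₀) :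
    AnalyticAt ℝ (fun t => (H t)ᴴ) t₀ :=
  ((conjTransposeL ι).analyticAt _).comp h

/-- Implicit function theorem with the ansatz U = exp(Z - Zᴴ), which is automatically unitary.
Requiring Z to vanish outside the block makes the system square. On such Z the linearization
multiplies the (i, j) entry by d i - d j, which is nonzero on the block. -/
theorem exists_analytic_unitary_block_diagonal {ι : Type*} [Fintype ι] [DecidableEq ι]
    {K : ℝ → Matrix ι ι ℂ} {t₀ : ℝ} (hK : AnalyticAt ℝ K t₀) {d : ι → ℂ}
    (hd : K t₀ = diagonal d) (p : ι → Prop) [DecidablePred p]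
    (hp : ∀ i j, p i → ¬ p j → d i ≠ d j) :
    ∃ U : ℝ → Matrix ι ι ℂ, AnalyticAt ℝ U t₀ ∧ ∀ᶠ t in 𝓝 t₀, (U t)ᴴ * U t = 1 ∧
      ∀ i j, p i → ¬ p j → ((U t)ᴴ * K t * U t) i j = 0 := by
  set L : Matrix ι ι ℂ →L[ℝ] Matrix ι ι ℂ := ContinuousLinearMap.id ℝ _ - conjTransposeL ι with hL
  have hLa : ∀ Z, L Z = Z - Zᴴ := fun Z => rfl
  set Φ : ℝ × Matrix ι ι ℂ → Matrix ι ι ℂ := fun x =>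
    blockMask p (NormedSpace.exp (-L x.2) * K x.1 * NormedSpace.exp (L x.2), x.2) with hΦ
  have hexp : ∀ x : Matrix ι ι ℂ, AnalyticAt ℝ NormedSpace.exp x := NormedSpace.exp_analytic
  have hΦan : AnalyticAt ℝ Φ (t₀, 0) := by
    refine ((blockMask p).analyticAt _).comp (AnalyticAt.prod ?_ analyticAt_snd)
    have h1 : AnalyticAt ℝ (fun x : ℝ × Matrix ι ι ℂ => L x.2) (t₀, 0) :=
      (L.analyticAt _).comp analyticAt_snd
    exact (((hexp _).comp h1.neg).mul
      (AnalyticAt.comp (x := ((t₀, 0) : ℝ × Matrix ι ι ℂ)) hK analyticAt_fst)).mul ((hexp _).comp h1)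
  have cdf : ContDiffAt ℝ ω Φ (t₀, 0) := hΦan.contDiffAt
  set A : Matrix ι ι ℂ →L[ℝ] Matrix ι ι ℂ := fderiv ℝ Φ (t₀, 0) ∘L .inr ℝ ℝ (Matrix ι ι ℂ) with hA
  have hAa : ∀ Z, A Z = blockMask p (K t₀ * L Z - L Z * K t₀, Z) := by
    have h1 : HasFDerivAt (fun Z => Φ (t₀, Z)) A 0 :=
      (cdf.differentiableAt (by simp)).hasFDerivAt.comp 0 (hasFDerivAt_prodMk_right t₀ 0)
    have h2 : HasFDerivAt (fun Z : Matrix ι ι ℂ => NormedSpace.exp (L Z)) L 0 := by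
      have := HasFDerivAt.comp (𝕜 := ℝ) (g := NormedSpace.exp) (f := L) (0 : Matrix ι ι ℂ)
        (by rw [map_zero]; exact hasFDerivAt_exp_zero (𝕂 := ℝ)) L.hasFDerivAt
      exact this
    have h3 : HasFDerivAt (fun Z : Matrix ι ι ℂ => NormedSpace.exp (-L Z)) (-L) 0 := by
      have := HasFDerivAt.comp (𝕜 := ℝ) (g := NormedSpace.exp) (f := -L) (0 : Matrix ι ι ℂ)
        (by rw [map_zero]; exact hasFDerivAt_exp_zero (𝕂 := ℝ)) (-L).hasFDerivAt
      exact this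
    have h4 := (blockMask p).hasFDerivAt.comp (0 : Matrix ι ι ℂ)
      (((h3.mul' (hasFDerivAt_const (K t₀) _)).mul' h2).prodMk (hasFDerivAt_id _))
    intro Z
    rw [h1.unique h4]
    change blockMask p ((NormedSpace.exp (-L 0) * K t₀) * L Z +
      (NormedSpace.exp (-L 0) * (0 : Matrix ι ι ℂ) + (-(L Z)) * K t₀) * NormedSpace.exp (L 0), Z) = _
    simp [sub_eq_add_neg]
  have hinj : Function.Injective A := by
    rw [injective_iff_map_eq_zero]
    intro Z hZ
    rw [hAa, hd] at hZ
    have h : ∀ i j, ¬ (p i ∧ ¬ p j) → Z i j = 0 := by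
      intro i j hij
      have := congrFun (congrFun hZ i) j
      rwa [blockMask_apply, if_neg hij] at this
    ext i j
    by_cases hij : p i ∧ ¬ p j
    · have h1 := congrFun (congrFun hZ i) j
      rw [blockMask_apply, if_pos hij] at h1
      have h2 : Z j i = 0 := h j i fun h => hij.2 h.1
      simp only [hLa, Matrix.sub_apply, diagonal_mul, mul_diagonal, conjTranspose_apply, h2, star_zero,
        sub_zero, Matrix.zero_apply] at h1
      have h3 : (d i - d j) * Z i j = 0 := by linear_combination h1
      exact (mul_eq_zero.mp h3).resolve_left (sub_ne_zero.mpr (hp i j hij.1 hij.2))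
    · exact h i j hij
  have hinv : A.IsInvertible :=
    ⟨(LinearEquiv.ofInjectiveEndo (A : Matrix ι ι ℂ →ₗ[ℝ] Matrix ι ι ℂ) hinj).toContinuousLinearEquiv,
      by ext1; rfl⟩
  set Z := cdf.implicitFunction (by simp) hinv with hZ
  have hZan : AnalyticAt ℝ Z t₀ :=
    analyticWithinAt_univ.mp (contDiffWithinAt_omega_iff_analyticWithinAt.mp
      (cdf.contDiffAt_implicitFunction (by simp) hinv))
  refine ⟨fun t => NormedSpace.exp (L (Z t)), (hexp _).comp ((L.analyticAt _).comp hZan), ?_⟩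
  have hstar : ∀ t, (NormedSpace.exp (L (Z t)))ᴴ = NormedSpace.exp (-L (Z t)) := by
    intro t
    rw [← exp_conjTranspose, hLa]; congr 1; simp
  filter_upwards [cdf.eventually_apply_implicitFunction (by simp) hinv] with t ht
  refine ⟨?_, fun i j hi hj => ?_⟩
  · rw [hstar, exp_neg]
    exact nonsing_inv_mul _ ((isUnit_iff_isUnit_det _).mp (isUnit_exp _))
  · have h1 := congrFun (congrFun ht i) j
    simp only [hΦ, blockMask_apply, hi, hj, not_false_eq_true, and_self, if_true] at h1
    rw [hstar]
    refine h1.trans ?_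
    simp [hd, show i ≠ j from fun h => hj (h ▸ hi)]

/-- Near `t₀` the eigenvalues of `H` are listed by functions that are analytic at `t₀`. -/
def HasAnalyticEigenvaluesAt {ι : Type*} [Fintype ι] [DecidableEq ι] (H : ℝ → Matrix ι ι ℂ)
    (t₀ : ℝ) : Prop :=
  ∃ ev : ι → ℝ → ℝ, (∀ j, AnalyticAt ℝ (ev j) t₀) ∧
    ∀ᶠ t in 𝓝 t₀, (H t).charpoly = ∏ j, (X - C (ev j t : ℂ))

theorem HasAnalyticEigenvaluesAt.congr {ι : Type*} [Fintype ι] [DecidableEq ι]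
    {H K : ℝ → Matrix ι ι ℂ} {t₀ : ℝ} (h : HasAnalyticEigenvaluesAt K t₀)
    (hHK : ∀ᶠ t in 𝓝 t₀, (H t).charpoly = (K t).charpoly) : HasAnalyticEigenvaluesAt H t₀ := by
  obtain ⟨ev, h1, h2⟩ := h
  exact ⟨ev, h1, by filter_upwards [h2, hHK] with t h h' using h'.trans h⟩

theorem HasAnalyticEigenvaluesAt.smul_one_add_smul {ι : Type*} [Fintype ι] [DecidableEq ι]
    {K : ℝ → Matrix ι ι ℂ} {t₀ : ℝ} (h : HasAnalyticEigenvaluesAt K t₀) {m s : ℝ → ℝ}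
    (hm : AnalyticAt ℝ m t₀) (hs : AnalyticAt ℝ s t₀) :
    HasAnalyticEigenvaluesAt (fun t => (m t : ℂ) • 1 + (s t : ℂ) • K t) t₀ := by
  obtain ⟨ev, h1, h2⟩ := h
  refine ⟨fun j t => m t + s t * ev j t, fun j => hm.add (hs.mul (h1 j)), ?_⟩
  filter_upwards [h2] with t ht
  exact (charpoly_smul_one_add_smul ht _ _).trans (by simp)

theorem Matrix.charpoly_eq_mul_of_block {ι : Type*} [Fintype ι] [DecidableEq ι]
    (M : Matrix ι ι ℂ) (p : ι → Prop) [DecidablePred p] (h : ∀ i, ¬ p i → ∀ j, p j → M i j = 0) :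
    M.charpoly = (toSquareBlockProp M p).charpoly *
      (toSquareBlockProp M fun i => ¬ p i).charpoly := by
  have key : ∀ (q : ι → Prop) [DecidablePred q], toSquareBlockProp M.charmatrix q =
      (toSquareBlockProp M q).charmatrix := by
    intro q _
    ext1 i j
    simp [toSquareBlockProp_def, charmatrix_apply, diagonal_apply, Subtype.ext_iff]
  rw [charpoly, twoBlockTriangular_det M.charmatrix p, key, key]
  · rfl
  · intro i hi j hj
    rw [charmatrix_apply_ne _ _ _ fun h : i = j => hi (h ▸ hj), h i hi j hj]
    simp

theorem HasAnalyticEigenvaluesAt.of_block {ι : Type*} [Fintype ι] [DecidableEq ι]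
    {K : ℝ → Matrix ι ι ℂ} {t₀ : ℝ} (p : ι → Prop) [DecidablePred p]
    (h : ∀ᶠ t in 𝓝 t₀, ∀ i, ¬ p i → ∀ j, p j → K t i j = 0)
    (h₁ : HasAnalyticEigenvaluesAt (fun t => toSquareBlockProp (K t) p) t₀)
    (h₂ : HasAnalyticEigenvaluesAt (fun t => toSquareBlockProp (K t) fun i => ¬ p i) t₀) :
    HasAnalyticEigenvaluesAt K t₀ := by
  obtain ⟨e₁, ha₁, hc₁⟩ := h₁
  obtain ⟨e₂, ha₂, hc₂⟩ := h₂
  refine ⟨fun j => if hj : p j then e₁ ⟨j, hj⟩ else e₂ ⟨j, hj⟩, fun j => ?_, ?_⟩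
  · by_cases hj : p j
    · simpa [hj] using ha₁ ⟨j, hj⟩
    · simpa [hj] using ha₂ ⟨j, hj⟩
  · filter_upwards [h, hc₁, hc₂] with t ht h1 h2
    rw [charpoly_eq_mul_of_block _ p ht, h1, h2, ← Fintype.prod_subtype_mul_prod_subtype p]
    congr 1
    · exact Finset.prod_congr rfl fun j _ => by simp [j.2]
    · exact Finset.prod_congr rfl fun j _ => by simp [j.2]

/-- **Rellich's theorem**: the eigenvalues of an analytic family of hermitian matrices can be
chosen analytically. -/
theorem Matrix.hasAnalyticEigenvaluesAt {ι : Type*} [Fintype ι] [DecidableEq ι]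
    {H : ℝ → Matrix ι ι ℂ} {t₀ : ℝ} (hH : AnalyticAt ℝ H t₀)
    (hherm : ∀ᶠ t in 𝓝 t₀, (H t).IsHermitian) : HasAnalyticEigenvaluesAt H t₀ := by
  induction hn : Fintype.card ι using Nat.strong_induction_on generalizing ι with
  | _ n ih =>
  subst hn
  -- Split off the scalar part, so that the remainder M is traceless.
  set m : ℝ → ℝ := fun t => (H t).trace.re / Fintype.card ι with hm
  have hma : AnalyticAt ℝ m t₀ :=
    ((Complex.reCLM.analyticAt _).comp hH.matrix_trace).div_const
  set M : ℝ → Matrix ι ι ℂ := fun t => H t - (m t : ℂ) • 1 with hM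
  have hMa : AnalyticAt ℝ M t₀ :=
    hH.sub (((Complex.ofRealCLM.analyticAt _).comp hma).smul analyticAt_const)
  have hMh : ∀ᶠ t in 𝓝 t₀, (M t).IsHermitian ∧ (M t).trace = 0 := by
    filter_upwards [hherm] with t ht
    refine ⟨ht.sub ?_, ?_⟩
    · simp [IsHermitian, conjTranspose_smul]
    · have h1 : ((H t).trace.re : ℂ) = (H t).trace := by
        rw [← Complex.conj_eq_iff_re, ← Complex.star_def, ← trace_conjTranspose, ht.eq]
      rcases isEmpty_or_nonempty ι with h | h
      · simp [trace]
      · simp [hM, hm, h1]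
  by_cases hM0 : ∀ᶠ t in 𝓝 t₀, M t = 0
  · refine ⟨fun _ => m, fun _ => hma, ?_⟩
    filter_upwards [hM0] with t ht
    have h1 : (0 : Matrix ι ι ℂ).charpoly = ∏ j : ι, (X - C 0) := by simp
    have h2 := charpoly_smul_one_add_smul (e := fun _ => 0) h1 (m t) 0
    rw [show H t = (m t : ℂ) • (1 : Matrix ι ι ℂ) + (0 : ℂ) • (0 : Matrix ι ι ℂ) by
      simpa using sub_eq_zero.mp ht, h2]
    simp
  -- Divide out the order of vanishing of M at t₀. This determines K only away from t₀; hermiticity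
  -- and zero trace reach t₀ by continuity.
  obtain ⟨k, K, hKa, hK0, hMK⟩ := hMa.exists_eventuallyEq_pow_smul_nonzero_iff.mpr hM0
  have hKh' : ∀ᶠ t in 𝓝[≠] t₀, (K t)ᴴ = K t ∧ (K t).trace = 0 := by
    filter_upwards [hMK.filter_mono nhdsWithin_le_nhds, hMh.filter_mono nhdsWithin_le_nhds,
      self_mem_nhdsWithin] with t h1 h2 h3
    have h4 : (t - t₀) ^ k ≠ 0 := pow_ne_zero _ (sub_ne_zero.mpr h3)
    have h5 : K t = ((t - t₀) ^ k)⁻¹ • M t := by rw [h1, smul_smul, inv_mul_cancel₀ h4, one_smul]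
    rw [h5]
    refine ⟨?_, by rw [trace_smul, h2.2, smul_zero]⟩
    rw [conjTranspose_smul, h2.1.eq, star_trivial]
  have hKh : ∀ᶠ t in 𝓝 t₀, (K t)ᴴ = K t :=
    (ContinuousAt.eventuallyEq_nhds_iff_eventuallyEq_nhdsNE
      hKa.matrix_conjTranspose.continuousAt hKa.continuousAt).mp (hKh'.mono fun t h => h.1)
  have hKtr : ∀ᶠ t in 𝓝 t₀, (K t).trace = 0 :=
    (ContinuousAt.eventuallyEq_nhds_iff_eventuallyEq_nhdsNE
      hKa.matrix_trace.continuousAt continuousAt_const).mp (hKh'.mono fun t h => h.2)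
  suffices hKe : HasAnalyticEigenvaluesAt K t₀ by
    refine (hKe.smul_one_add_smul (s := fun t => (t - t₀) ^ k) hma (by fun_prop)).congr ?_
    filter_upwards [hMK] with t ht
    congr 1
    rw [← sub_eq_iff_eq_add']
    rw [Complex.coe_smul]
    exact ht
  have hK₀ : (K t₀).IsHermitian := hKh.self_of_nhds
  set V : Matrix ι ι ℂ := hK₀.eigenvectorUnitary.1 with hV
  have hV1 : Vᴴ * V = 1 := Unitary.coe_star_mul_self hK₀.eigenvectorUnitary
  have hV2 : V * Vᴴ = 1 := Unitary.coe_mul_star_self hK₀.eigenvectorUnitary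
  set d := hK₀.eigenvalues with hd
  have hVK : Vᴴ * K t₀ * V = diagonal (fun i => (d i : ℂ)) := by
    have h1 : K t₀ = V * diagonal (fun i => (d i : ℂ)) * Vᴴ := hK₀.spectral_theorem
    rw [h1]
    simp only [Matrix.mul_assoc, hV1, Matrix.mul_one]
    rw [← Matrix.mul_assoc, hV1, Matrix.one_mul]
  -- A nonzero traceless hermitian matrix has two distinct eigenvalues, so the splitting below is
  -- into proper blocks and the induction on size applies.
  obtain ⟨i₀, i₁, hi⟩ : ∃ i₀ i₁, d i₁ ≠ d i₀ := by
    by_contra! hcon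
    apply hK0
    have h1 : ∑ i, (d i : ℂ) = 0 := by
      have := hK₀.trace_eq_sum_eigenvalues
      rw [hKtr.self_of_nhds] at this
      exact this.symm
    have h2 : ∀ i, d i = 0 := by
      intro i
      have h3 : ∑ j, (d j : ℂ) = Fintype.card ι * d i := by
        rw [Finset.sum_congr rfl fun j _ => by rw [hcon i j]]
        simp
      rw [h3] at h1
      have : Nonempty ι := ⟨i⟩
      simpa using h1
    have h4 : K t₀ = V * diagonal (fun i => (d i : ℂ)) * Vᴴ := hK₀.spectral_theorem
    rw [h4]
    simp [h2]
  have hVKa : AnalyticAt ℝ (fun t => Vᴴ * K t * V) t₀ :=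
    (analyticAt_const.mul hKa).mul analyticAt_const
  classical
  set p : ι → Prop := fun i => d i = d i₀ with hp
  obtain ⟨U, hUa, hU⟩ := exists_analytic_unitary_block_diagonal hVKa hVK p
    (by intro i j h1 h2 h3; exact h2 ((Complex.ofReal_injective h3).symm.trans h1))
  set B : ℝ → Matrix ι ι ℂ := fun t => (U t)ᴴ * (Vᴴ * K t * V) * U t with hB
  have hBa : AnalyticAt ℝ B t₀ := (hUa.matrix_conjTranspose.mul hVKa).mul hUa
  have hBh : ∀ᶠ t in 𝓝 t₀, (B t)ᴴ = B t := by
    filter_upwards [hKh] with t ht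
    simp [hB, conjTranspose_mul, ht, Matrix.mul_assoc]
  have hsub : ∀ q : ι → Prop, [DecidablePred q] → (∃ i, ¬ q i) →
      HasAnalyticEigenvaluesAt (fun t => toSquareBlockProp (B t) q) t₀ := by
    intro q _ hq
    refine ih _ (Fintype.card_subtype_lt hq.choose_spec) ?_ ?_ rfl
    · rw [analyticAt_iff_entries] at hBa ⊢
      exact fun i j => hBa i j
    · filter_upwards [hBh] with t ht
      ext i j
      exact congrFun (congrFun ht i) j
  refine (HasAnalyticEigenvaluesAt.of_block (K := B) p ?_ (hsub p ⟨i₁, hi⟩)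
    (hsub _ ⟨i₀, by simp [hp]⟩)).congr ?_
  · filter_upwards [hU, hBh] with t ht h i hi j hj
    rw [← h, conjTranspose_apply]
    exact (congrArg star (ht.2 j i hj hi)).trans (star_zero ℂ)
  · filter_upwards [hU] with t ht
    rw [hB]
    dsimp only
    rw [charpoly_mul_comm, ← Matrix.mul_assoc, mul_eq_one_comm.mp ht.1, Matrix.one_mul,
      charpoly_mul_comm, ← Matrix.mul_assoc, hV2, Matrix.one_mul]

end Rellich

/-! ### Hermite interpolation and divided differences. -/

section Interpolation

/-- The nodal polynomial N vanishes simply at each node, so adding N * Q to the Lagrange interpolant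
P keeps the values and lets Q prescribe the derivatives. -/
theorem Polynomial.exists_hermite_interpolation (s : Finset ℝ) (g g₁ : ℝ → ℝ) :
    ∃ q : Polynomial ℝ, ∀ x ∈ s, q.eval x = g x ∧ q.derivative.eval x = g₁ x := by
  have hinj : Set.InjOn (id : ℝ → ℝ) s := Set.injOn_id _
  set N := Lagrange.nodal s (id : ℝ → ℝ) with hN
  set P := Lagrange.interpolate s id g with hP
  set Q := Lagrange.interpolate s id
    (fun x => (g₁ x - P.derivative.eval x) / N.derivative.eval x) with hQ
  refine ⟨P + N * Q, fun x hx => ?_⟩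
  have hN0 : N.eval x = 0 := Lagrange.eval_nodal_at_node (v := id) hx
  have hPx : P.eval x = g x := Lagrange.eval_interpolate_at_node g hinj hx
  have hQx : Q.eval x = (g₁ x - P.derivative.eval x) / N.derivative.eval x :=
    Lagrange.eval_interpolate_at_node _ hinj hx
  have hN1 : N.derivative.eval x ≠ 0 := by
    have h1 := Lagrange.nodalWeight_eq_eval_derivative_nodal (v := (id : ℝ → ℝ)) hx
    have h2 := Lagrange.nodalWeight_ne_zero hinj hx
    intro h0
    rw [h1] at h2
    exact h2 (by simpa using h0)
  constructor
  · simp [hN0, hPx]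
  · simp only [Polynomial.derivative_add, Polynomial.derivative_mul, Polynomial.eval_add,
      Polynomial.eval_mul, hN0, hQx]
    field_simp; ring

/-- The divided difference of `g`, with value `g₁` on the diagonal. -/
noncomputable def dividedDiff (g g₁ : ℝ → ℝ) (x y : ℝ) : ℝ :=
  if x = y then g₁ x else (g x - g y) / (x - y)

/-- This is the kernel produced by the noncommutative Leibniz rule for a matrix power. At m = 0 both
sides are zero, so the truncated m - 1 is harmless. -/
theorem dividedDiff_pow (m : ℕ) (x y : ℝ) :
    dividedDiff (fun x => x ^ m) (fun x => m * x ^ (m - 1)) x y =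
      ∑ i ∈ Finset.range m, x ^ (m - 1 - i) * y ^ i := by
  unfold dividedDiff
  split_ifs with h
  · subst h
    rw [Finset.sum_congr rfl (g := fun _ => x ^ (m - 1)) fun i hi => by
      rw [← pow_add, show m - 1 - i + i = m - 1 from
        Nat.sub_add_cancel (Nat.le_pred_of_lt (Finset.mem_range.mp hi))]]
    simp
  · have h1 := (Commute.all y x).geom_sum₂_mul m
    rw [div_eq_iff (sub_ne_zero.mpr h)]
    simp_rw [mul_comm (x ^ _)]
    linear_combination h1

end Interpolation

/-! ### Traces expressed in an eigenbasis. -/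

section Spectral
open Matrix

variable {n : ℕ}

/-- The matrix of `B` in an orthonormal eigenbasis of the hermitian matrix `A`. -/
noncomputable def Matrix.IsHermitian.inEigenbasis {A : Matrix (Fin n) (Fin n) ℂ}
    (hA : A.IsHermitian) (B : Matrix (Fin n) (Fin n) ℂ) : Matrix (Fin n) (Fin n) ℂ :=
  (hA.eigenvectorUnitary.1)ᴴ * B * hA.eigenvectorUnitary.1

theorem Matrix.IsHermitian.inEigenbasis_star {A : Matrix (Fin n) (Fin n) ℂ} (hA : A.IsHermitian)
    {B : Matrix (Fin n) (Fin n) ℂ} (hB : B.IsHermitian) (j k : Fin n) :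
    hA.inEigenbasis B k j = star (hA.inEigenbasis B j k) := by
  have : (hA.inEigenbasis B)ᴴ = hA.inEigenbasis B := by
    simp [inEigenbasis, conjTranspose_mul, hB.eq, Matrix.mul_assoc]
  rw [← conjTranspose_apply, this]

theorem Matrix.IsHermitian.inEigenbasis_mul_re {A : Matrix (Fin n) (Fin n) ℂ} (hA : A.IsHermitian)
    {B : Matrix (Fin n) (Fin n) ℂ} (hB : B.IsHermitian) (j k : Fin n) :
    hA.inEigenbasis B j k * hA.inEigenbasis B k j = ((‖hA.inEigenbasis B j k‖ ^ 2 : ℝ) : ℂ) := by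
  rw [hA.inEigenbasis_star hB j k, Complex.star_def, Complex.mul_conj, Complex.normSq_eq_norm_sq]

theorem Matrix.IsHermitian.norm_inEigenbasis_symm {A : Matrix (Fin n) (Fin n) ℂ}
    (hA : A.IsHermitian) {B : Matrix (Fin n) (Fin n) ℂ} (hB : B.IsHermitian) (j k : Fin n) :
    ‖hA.inEigenbasis B j k‖ = ‖hA.inEigenbasis B k j‖ := by
  rw [hA.inEigenbasis_star hB k j, norm_star]

theorem Matrix.IsHermitian.cfc_eq_mul {A : Matrix (Fin n) (Fin n) ℂ} (hA : A.IsHermitian)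
    (g : ℝ → ℝ) : cfc g A = hA.eigenvectorUnitary.1 *
      diagonal (fun j => (g (hA.eigenvalues j) : ℂ)) * (hA.eigenvectorUnitary.1)ᴴ := by
  rw [hA.cfc_eq]; rfl

theorem Matrix.IsHermitian.inEigenbasis_mul {A : Matrix (Fin n) (Fin n) ℂ} (hA : A.IsHermitian)
    (B D : Matrix (Fin n) (Fin n) ℂ) :
    hA.inEigenbasis (B * D) = hA.inEigenbasis B * hA.inEigenbasis D := by
  have h : hA.eigenvectorUnitary.1 * (hA.eigenvectorUnitary.1)ᴴ = 1 :=
    Unitary.coe_mul_star_self hA.eigenvectorUnitary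
  unfold inEigenbasis
  simp only [Matrix.mul_assoc]
  rw [← Matrix.mul_assoc hA.eigenvectorUnitary.1 _ (D * _), h, Matrix.one_mul]

theorem Matrix.IsHermitian.inEigenbasis_cfc {A : Matrix (Fin n) (Fin n) ℂ} (hA : A.IsHermitian)
    (g : ℝ → ℝ) :
    hA.inEigenbasis (cfc g A) = diagonal (fun j => (g (hA.eigenvalues j) : ℂ)) := by
  have h : (hA.eigenvectorUnitary.1)ᴴ * hA.eigenvectorUnitary.1 = 1 :=
    Unitary.coe_star_mul_self hA.eigenvectorUnitary
  rw [hA.cfc_eq_mul, inEigenbasis]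
  simp only [Matrix.mul_assoc, h, Matrix.mul_one]
  rw [← Matrix.mul_assoc, h, Matrix.one_mul]

theorem Matrix.IsHermitian.inEigenbasis_self {A : Matrix (Fin n) (Fin n) ℂ} (hA : A.IsHermitian) :
    hA.inEigenbasis A = diagonal (fun j => (hA.eigenvalues j : ℂ)) := by
  have := hA.inEigenbasis_cfc id
  rwa [cfc_id ℝ A] at this

theorem Matrix.IsHermitian.trace_inEigenbasis {A : Matrix (Fin n) (Fin n) ℂ} (hA : A.IsHermitian)
    (B : Matrix (Fin n) (Fin n) ℂ) : (hA.inEigenbasis B).trace = B.trace := by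
  have h : hA.eigenvectorUnitary.1 * (hA.eigenvectorUnitary.1)ᴴ = 1 :=
    Unitary.coe_mul_star_self hA.eigenvectorUnitary
  rw [inEigenbasis, trace_mul_comm, ← Matrix.mul_assoc, h, Matrix.one_mul]

theorem Matrix.IsHermitian.trace_cfc {A : Matrix (Fin n) (Fin n) ℂ} (hA : A.IsHermitian)
    (g : ℝ → ℝ) : (cfc g A).trace.re = ∑ j, g (hA.eigenvalues j) := by
  rw [← hA.trace_inEigenbasis, hA.inEigenbasis_cfc]
  simp [trace]

theorem Matrix.IsHermitian.cfc_pow_eq {A : Matrix (Fin n) (Fin n) ℂ} (hA : A.IsHermitian)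
    (m : ℕ) : cfc (fun x : ℝ => x ^ m) A = A ^ m :=
  cfc_pow_id (R := ℝ) A m hA

theorem Matrix.IsHermitian.trace_pow_re {A : Matrix (Fin n) (Fin n) ℂ} (hA : A.IsHermitian)
    (m : ℕ) : (A ^ m).trace.re = ∑ j, hA.eigenvalues j ^ m := by
  rw [← hA.cfc_pow_eq, hA.trace_cfc]

theorem Matrix.IsHermitian.trace_cfc_mul {A : Matrix (Fin n) (Fin n) ℂ} (hA : A.IsHermitian)
    (g : ℝ → ℝ) (B : Matrix (Fin n) (Fin n) ℂ) :
    (cfc g A * B).trace = ∑ j, (g (hA.eigenvalues j) : ℂ) * hA.inEigenbasis B j j := by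
  rw [← hA.trace_inEigenbasis, hA.inEigenbasis_mul, hA.inEigenbasis_cfc]
  simp [trace, diagonal_mul]

theorem Matrix.IsHermitian.trace_cfc_mul_mul_cfc_mul {A : Matrix (Fin n) (Fin n) ℂ}
    (hA : A.IsHermitian) (g h : ℝ → ℝ) {B : Matrix (Fin n) (Fin n) ℂ} (hB : B.IsHermitian) :
    (cfc g A * B * cfc h A * B).trace.re = ∑ j, ∑ k, ‖hA.inEigenbasis B j k‖ ^ 2 *
      (g (hA.eigenvalues j) * h (hA.eigenvalues k)) := by
  rw [← hA.trace_inEigenbasis]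
  simp only [hA.inEigenbasis_mul, hA.inEigenbasis_cfc, trace, diag_apply, Complex.re_sum]
  refine Finset.sum_congr rfl fun j _ => ?_
  rw [Matrix.mul_apply, Complex.re_sum]
  refine Finset.sum_congr rfl fun k _ => ?_
  rw [mul_diagonal, diagonal_mul, ← Complex.ofReal_re (_ * _)]
  congr 1
  have := hA.inEigenbasis_mul_re hB j k
  push_cast at this ⊢
  rw [← this]; ring

/-- Both lists are the multiset of roots of the characteristic polynomial, so no regularity of φ is
needed. -/
theorem Matrix.IsHermitian.sum_eq_of_charpoly_eq {A : Matrix (Fin n) (Fin n) ℂ}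
    (hA : A.IsHermitian) {e : Fin n → ℝ} (he : A.charpoly = ∏ j, (X - C (e j : ℂ))) (φ : ℝ → ℝ) :
    ∑ j, φ (e j) = ∑ j, φ (hA.eigenvalues j) := by
  have h1 : (Finset.univ.val.map fun j => (e j : ℂ)) =
      Finset.univ.val.map fun j => (hA.eigenvalues j : ℂ) := by
    have h2 := hA.roots_charpoly_eq_eigenvalues
    rw [he, Polynomial.roots_prod _ _ (Finset.prod_ne_zero_iff.mpr fun j _ =>
      Polynomial.X_sub_C_ne_zero _)] at h2
    simpa [Function.comp_def] using h2
  have h3 : Finset.univ.val.map e = Finset.univ.val.map hA.eigenvalues := by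
    apply Multiset.map_injective Complex.ofReal_injective
    simpa [Multiset.map_map, Function.comp_def] using h1
  have h4 := congrArg (fun s => (s.map φ).sum) h3
  rw [Multiset.map_map, Multiset.map_map] at h4
  exact h4

theorem mem_spectrum_of_charpoly_eq {A : Matrix (Fin n) (Fin n) ℂ}
    (hA : A.IsHermitian) {e : Fin n → ℝ} (he : A.charpoly = ∏ j, (X - C (e j : ℂ))) (j : Fin n) :
    e j ∈ spectrum ℝ A := by
  classical
  by_contra hj
  -- Test against the indicator of the complement of the spectrum.
  have h := hA.sum_eq_of_charpoly_eq he (fun x => if x ∈ spectrum ℝ A then 0 else 1)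
  simp only [hA.eigenvalues_mem_spectrum_real, if_true, Finset.sum_const_zero] at h
  rw [Finset.sum_eq_zero_iff_of_nonneg (by intro i _; split_ifs <;> norm_num)] at h
  simpa [hj] using h j (Finset.mem_univ j)

end Spectral

/-! ### Differentiating the family and its power traces. -/

section Derivatives
open Matrix
open scoped Matrix.Norms.Operator

variable {n : ℕ}

theorem hasDerivAt_matDeriv {H : ℝ → Matrix (Fin n) (Fin n) ℂ} {t : ℝ}
    (hH : ∀ i j, AnalyticAt ℝ (fun s => H s i j) t) : HasDerivAt H (matDeriv H t) t := by
  have h := (analyticAt_iff_entries.mpr hH).differentiableAt.hasDerivAt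
  convert! h using 1
  ext i j
  exact ((entryLinearMap ℝ ℂ i j).toContinuousLinearMap.hasFDerivAt.comp_hasDerivAt t h).deriv

theorem HasDerivAt.matrix_trace_re {M : ℝ → Matrix (Fin n) (Fin n) ℂ}
    {M' : Matrix (Fin n) (Fin n) ℂ} {t : ℝ} (h : HasDerivAt M M' t) :
    HasDerivAt (fun s => (M s).trace.re) M'.trace.re t :=
  (Complex.reCLM ∘L (traceLinearMap (Fin n) ℝ ℂ).toContinuousLinearMap).hasFDerivAt.comp_hasDerivAt
    t h

namespace IsAnalyticHermitianFamily

variable {T I : Set ℝ} {H : ℝ → Matrix (Fin n) (Fin n) ℂ}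

theorem hasDerivAt (hH : IsAnalyticHermitianFamily T I H) {t : ℝ} (ht : t ∈ T) :
    HasDerivAt H (matDeriv H t) t :=
  hasDerivAt_matDeriv fun i j => hH.analytic i j t ht

theorem hasDerivAt_deriv (hH : IsAnalyticHermitianFamily T I H) {t : ℝ} (ht : t ∈ T) :
    HasDerivAt (matDeriv H) (matDeriv (matDeriv H) t) t :=
  hasDerivAt_matDeriv fun i j => (hH.analytic i j).deriv t ht

theorem isHermitian_matDeriv (hH : IsAnalyticHermitianFamily T I H) (hT : IsOpen T) {t : ℝ}
    (ht : t ∈ T) : (matDeriv H t).IsHermitian := by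
  have h1 : HasDerivAt (fun s => (H s)ᴴ) (matDeriv H t)ᴴ t :=
    (conjTransposeL (Fin n)).hasFDerivAt.comp_hasDerivAt t (hH.hasDerivAt ht)
  refine (h1.congr_of_eventuallyEq ?_).unique (hH.hasDerivAt ht)
  filter_upwards [hT.mem_nhds ht] with s hs using (hH.hermitian s hs).eq.symm

theorem exists_labelling (hH : IsAnalyticHermitianFamily T I H) (hT : IsOpen T) {t : ℝ}
    (ht : t ∈ T) : ∃ ev, IsAnalyticEigenvalueLabelling H t ev := by
  obtain ⟨ev, h1, h2⟩ := hasAnalyticEigenvaluesAt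
    (analyticAt_iff_entries.mpr fun i j => hH.analytic i j t ht)
    (by filter_upwards [hT.mem_nhds ht] with s hs using hH.hermitian s hs)
  exact ⟨ev, h1, h2⟩

/-- Differentiating Tr H^(m+1) = Σ λ^(m+1) near τ, using cyclicity of the trace, and cancelling m +
1 gives Tr(H^m Ḣ) = Σ λ^m λ̇. Differentiating once more at τ gives the claim. -/
theorem sum_pow_deriv2 (hH : IsAnalyticHermitianFamily T I H) (hT : IsOpen T) {τ : ℝ}
    (hτ : τ ∈ T) {ev : Fin n → ℝ → ℝ} (hev : IsAnalyticEigenvalueLabelling H τ ev) (m : ℕ) :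
    ∑ j, (m * ev j τ ^ (m - 1) * deriv (ev j) τ ^ 2 + ev j τ ^ m * deriv (deriv (ev j)) τ) =
      (H τ ^ m * matDeriv (matDeriv H) τ).trace.re +
      ∑ i ∈ Finset.range m,
        (H τ ^ (m - 1 - i) * matDeriv H τ * H τ ^ i * matDeriv H τ).trace.re := by
  have hev1 : ∀ᶠ t in 𝓝 τ, ∀ j, AnalyticAt ℝ (ev j) t :=
    Filter.eventually_all.mpr fun j => (hev.analytic j).eventually_analyticAt
  have hRd : ∀ t ∈ T, HasDerivAt (fun t => (H t ^ (m + 1)).trace.re)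
      ((m + 1) * (H t ^ m * matDeriv H t).trace.re) t := by
    intro t ht
    have h := ((hH.hasDerivAt ht).fun_pow' (m + 1)).matrix_trace_re
    convert! h using 1
    rw [trace_sum, Complex.re_sum, Finset.sum_congr rfl (g := fun _ => (H t ^ m * matDeriv H t).trace.re)]
    · simp
    · intro i hi
      rw [trace_mul_comm, ← Matrix.mul_assoc, ← pow_add]
      congr 4
      have := Finset.mem_range.mp hi
      simp only [Nat.pred_eq_sub_one]
      omega
  have heq1 : (fun t => (H t ^ (m + 1)).trace.re) =ᶠ[𝓝 τ] fun t => ∑ j, ev j t ^ (m + 1) := by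
    filter_upwards [hev.charpoly_eq, hT.mem_nhds hτ] with t h1 h2
    rw [(hH.hermitian t h2).trace_pow_re,
      (hH.hermitian t h2).sum_eq_of_charpoly_eq h1 (fun x => x ^ (m + 1))]
  have heq2 : (fun t => (H t ^ m * matDeriv H t).trace.re) =ᶠ[𝓝 τ]
      fun t => ∑ j, ev j t ^ m * deriv (ev j) t := by
    filter_upwards [heq1.eventuallyEq_nhds, hev1, hT.mem_nhds hτ] with t h1 h2 h3
    have h4 : HasDerivAt (fun t => ∑ j, ev j t ^ (m + 1))
        (∑ j, ((m + 1 : ℕ) : ℝ) * ev j t ^ m * deriv (ev j) t) t :=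
      HasDerivAt.fun_sum fun j _ => (h2 j).differentiableAt.hasDerivAt.pow (m + 1)
    have h5 := (hRd t h3).unique (h4.congr_of_eventuallyEq h1)
    have h6 : ((m : ℝ) + 1) ≠ 0 := by positivity
    apply mul_left_cancel₀ h6
    rw [h5, Finset.mul_sum]
    exact Finset.sum_congr rfl fun j _ => by push_cast; ring
  have hd1 : HasDerivAt (fun t => ∑ j, ev j t ^ m * deriv (ev j) t)
      (∑ j, (m * ev j τ ^ (m - 1) * deriv (ev j) τ * deriv (ev j) τ +
        ev j τ ^ m * deriv (deriv (ev j)) τ)) τ :=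
    HasDerivAt.fun_sum fun j _ => ((hev.analytic j).differentiableAt.hasDerivAt.pow m).mul
      (hev.analytic j).deriv.differentiableAt.hasDerivAt
  have hd2 := (((hH.hasDerivAt hτ).fun_pow' m).mul (hH.hasDerivAt_deriv hτ)).matrix_trace_re
  have h := hd1.unique (hd2.congr_of_eventuallyEq heq2.symm)
  rw [Finset.sum_mul, trace_add, trace_sum, Complex.add_re, Complex.re_sum] at h
  simp only [Nat.pred_eq_sub_one] at h
  rw [add_comm, ← h]
  exact Finset.sum_congr rfl fun j _ => by ring

end IsAnalyticHermitianFamily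

end Derivatives

/-! ### The second-derivative identity for arbitrary values of g and g₁. -/

section TraceIdentity
open Matrix

variable {n : ℕ}

namespace IsAnalyticHermitianFamily

variable {T I : Set ℝ} {H : ℝ → Matrix (Fin n) (Fin n) ℂ}

theorem eventually_sum_eq (hH : IsAnalyticHermitianFamily T I H) (hT : IsOpen T) {τ : ℝ}
    (hτ : τ ∈ T) {ev : Fin n → ℝ → ℝ} (hev : IsAnalyticEigenvalueLabelling H τ ev) (φ : ℝ → ℝ) :
    (fun t => (cfc φ (H t)).trace.re) =ᶠ[𝓝 τ] fun t => ∑ j, φ (ev j t) := by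
  filter_upwards [hev.charpoly_eq, hT.mem_nhds hτ] with t h1 h2
  rw [(hH.hermitian t h2).trace_cfc, (hH.hermitian t h2).sum_eq_of_charpoly_eq h1]

theorem eventually_mem (hH : IsAnalyticHermitianFamily T I H) (hT : IsOpen T) {τ : ℝ}
    (hτ : τ ∈ T) {ev : Fin n → ℝ → ℝ} (hev : IsAnalyticEigenvalueLabelling H τ ev) :
    ∀ᶠ t in 𝓝 τ, ∀ j, ev j t ∈ I := by
  filter_upwards [hev.charpoly_eq, hT.mem_nhds hτ] with t h1 h2 j
  exact hH.spectrum_subset t h2 (mem_spectrum_of_charpoly_eq (hH.hermitian t h2) h1 j)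

/-- Here g₁ need not be the derivative of g: both sides see only the values of g and g₁ on the
spectrum at τ, so a Hermite interpolant may replace the pair. This freedom is used with g₁ = 0 for
the first statement. -/
theorem sum_deriv2_eq (hH : IsAnalyticHermitianFamily T I H) (hT : IsOpen T) {τ : ℝ}
    (hτ : τ ∈ T) {ev : Fin n → ℝ → ℝ} (hev : IsAnalyticEigenvalueLabelling H τ ev)
    (hA : (H τ).IsHermitian) (g g₁ : ℝ → ℝ) :
    ∑ j, (g₁ (ev j τ) * deriv (ev j) τ ^ 2 + g (ev j τ) * deriv (deriv (ev j)) τ) =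
      (cfc g (H τ) * matDeriv (matDeriv H) τ).trace.re +
      ∑ j, ∑ k, ‖hA.inEigenbasis (matDeriv H τ) j k‖ ^ 2 *
        dividedDiff g g₁ (hA.eigenvalues j) (hA.eigenvalues k) := by
  have hB := hH.isHermitian_matDeriv hT hτ
  have hpoly : ∀ q : Polynomial ℝ,
      ∑ j, (q.derivative.eval (ev j τ) * deriv (ev j) τ ^ 2 +
        q.eval (ev j τ) * deriv (deriv (ev j)) τ) =
      (cfc (fun x => q.eval x) (H τ) * matDeriv (matDeriv H) τ).trace.re +
      ∑ j, ∑ k, ‖hA.inEigenbasis (matDeriv H τ) j k‖ ^ 2 *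
        dividedDiff (fun x => q.eval x) (fun x => q.derivative.eval x)
          (hA.eigenvalues j) (hA.eigenvalues k) := by
    intro q
    induction q using Polynomial.induction_on' with
    | add p q hp hq =>
      have hdd : ∀ x y, dividedDiff (fun x => (p + q).eval x)
          (fun x => (p + q).derivative.eval x) x y =
          dividedDiff (fun x => p.eval x) (fun x => p.derivative.eval x) x y +
          dividedDiff (fun x => q.eval x) (fun x => q.derivative.eval x) x y := by
        intro x y
        unfold dividedDiff
        split_ifs
        · simp
        · simp only [Polynomial.eval_add]; ring
      simp only [hdd, hA.trace_cfc_mul] at hp hq ⊢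
      simp only [Polynomial.derivative_add, Polynomial.eval_add, add_mul, mul_add,
        Complex.ofReal_add, Finset.sum_add_distrib, Complex.add_re] at hp hq ⊢
      linear_combination hp + hq
    | monomial m a =>
      have h := hH.sum_pow_deriv2 hT hτ hev m
      simp only [← hA.cfc_pow_eq] at h
      simp only [hA.trace_cfc_mul_mul_cfc_mul _ _ hB, hA.trace_cfc_mul] at h
      rw [Finset.sum_comm] at h
      simp only [Finset.sum_comm (s := Finset.range m), ← Finset.mul_sum, ← dividedDiff_pow] at h
      have hdd : ∀ x y, dividedDiff (fun x => (Polynomial.monomial m a).eval x)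
          (fun x => (Polynomial.monomial m a).derivative.eval x) x y =
          a * dividedDiff (fun x => x ^ m) (fun x => m * x ^ (m - 1)) x y := by
        intro x y
        unfold dividedDiff
        split_ifs
        · simp [Polynomial.derivative_monomial, mul_assoc]
        · simp only [Polynomial.eval_monomial]; ring
      simp only [hdd, hA.trace_cfc_mul]
      simp only [Polynomial.derivative_monomial, Polynomial.eval_monomial]
      have h' := congrArg (fun x => a * x) h
      simp only [mul_add, Finset.mul_sum, Complex.re_sum] at h' ⊢
      convert h' using 2
      · ring
      · refine Finset.sum_congr rfl fun j _ => ?_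
        rw [Complex.ofReal_mul, mul_assoc, Complex.re_ofReal_mul]
      · exact Finset.sum_congr rfl fun j _ => Finset.sum_congr rfl fun k _ => by ring
  obtain ⟨q, hq⟩ := Polynomial.exists_hermite_interpolation
    (Finset.univ.image hA.eigenvalues) g g₁
  have hq' : ∀ j, q.eval (hA.eigenvalues j) = g (hA.eigenvalues j) ∧
      q.derivative.eval (hA.eigenvalues j) = g₁ (hA.eigenvalues j) := fun j =>
    hq _ (Finset.mem_image_of_mem _ (Finset.mem_univ j))
  have hqe : ∀ j, q.eval (ev j τ) = g (ev j τ) ∧ q.derivative.eval (ev j τ) = g₁ (ev j τ) := by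
    intro j
    have h := mem_spectrum_of_charpoly_eq hA hev.charpoly_eq.self_of_nhds j
    rw [hA.spectrum_real_eq_range_eigenvalues] at h
    obtain ⟨k, hk⟩ := h
    rw [← hk]; exact hq' k
  have h := hpoly q
  simp only [hqe, hA.trace_cfc_mul, hq'] at h
  rw [h, hA.trace_cfc_mul]
  congr 1
  refine Finset.sum_congr rfl fun j _ => Finset.sum_congr rfl fun k _ => ?_
  simp only [dividedDiff, hq']

end IsAnalyticHermitianFamily

end TraceIdentity

/-! ### Error signs of the trapezoidal rule and of its corrected form. -/

section Quadrature
open Set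

theorem ConvexOn.le_chord {g : ℝ → ℝ} {x y t : ℝ} (hg : ConvexOn ℝ (Icc x y) g) (hxy : x < y)
    (ht : t ∈ Icc x y) : g t ≤ g x + (t - x) * ((g y - g x) / (y - x)) := by
  have h0 : 0 < y - x := sub_pos.mpr hxy
  have h := hg.2 (left_mem_Icc.mpr hxy.le) (right_mem_Icc.mpr hxy.le)
    (show 0 ≤ (y - t) / (y - x) from div_nonneg (sub_nonneg.mpr ht.2) h0.le)
    (show 0 ≤ (t - x) / (y - x) from div_nonneg (sub_nonneg.mpr ht.1) h0.le)
    (by field_simp; ring)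
  simp only [smul_eq_mul] at h
  have h1 : (y - t) / (y - x) * x + (t - x) / (y - x) * y = t := by field_simp; ring
  rw [h1] at h
  refine h.trans (le_of_eq ?_)
  field_simp; ring

/-- The trapezoidal rule overestimates the integral of a convex function. -/
theorem sub_le_trapezoid_of_convexOn {g g' : ℝ → ℝ} {x y : ℝ} (hxy : x < y)
    (hd : ∀ t ∈ Icc x y, HasDerivWithinAt g (g' t) (Icc x y) t) (hg : ConvexOn ℝ (Icc x y) g') :
    g y - g x ≤ (y - x) * ((g' x + g' y) / 2) := by
  set s := (g' y - g' x) / (y - x) with hs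
  have hsy : s * (y - x) = g' y - g' x := div_mul_cancel₀ _ (sub_pos.mpr hxy).ne'
  -- Subtract the antiderivative of the chord of g'. The trapezoidal rule is exact for it, and the
  -- remainder is antitone because g' lies below its chord.
  have hr : ∀ t ∈ Icc x y, HasDerivWithinAt
      (fun t => g t - (g' x * (t - x) + s / 2 * (t - x) ^ 2))
      (g' t - (g' x + (t - x) * s)) (Icc x y) t := by
    intro t ht
    refine (hd t ht).sub (HasDerivAt.hasDerivWithinAt ?_)
    have h1 : HasDerivAt (fun t => t - x) 1 t := (hasDerivAt_id t).sub_const x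
    convert! (h1.const_mul (g' x)).add ((h1.pow 2).const_mul (s / 2)) using 1
    ring
  have hanti := antitoneOn_of_hasDerivWithinAt_nonpos (convex_Icc x y)
    (fun t ht => (hr t ht).continuousWithinAt)
    (fun t ht => (hr t (interior_subset ht)).mono interior_subset)
    (fun t ht => sub_nonpos.mpr (hg.le_chord hxy (interior_subset ht)))
  have h := hanti (left_mem_Icc.mpr hxy.le) (right_mem_Icc.mpr hxy.le) hxy.le
  simp only [sub_self] at h
  have h2 : s / 2 * (y - x) ^ 2 = (y - x) * ((g' y - g' x) / 2) := by rw [← hsy]; ring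
  rw [h2] at h
  linarith

theorem trapezoid_le_sub_of_concaveOn {g g' : ℝ → ℝ} {x y : ℝ} (hxy : x < y)
    (hd : ∀ t ∈ Icc x y, HasDerivWithinAt g (g' t) (Icc x y) t) (hg : ConcaveOn ℝ (Icc x y) g') :
    (y - x) * ((g' x + g' y) / 2) ≤ g y - g x := by
  have h := sub_le_trapezoid_of_convexOn (g := fun t => -g t) (g' := fun t => -g' t) hxy
    (fun t ht => (hd t ht).neg) hg.neg
  linarith

/-- The corrected trapezoidal rule underestimates the integral of a function with convex second
derivative. -/
theorem corrected_trapezoid_le_sub_of_convexOn {g g₁ g₂ g₃ : ℝ → ℝ} {x y : ℝ} (hxy : x < y)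
    (hd : ∀ t ∈ Icc x y, HasDerivWithinAt g (g₁ t) (Icc x y) t)
    (hd₁ : ∀ t ∈ Icc x y, HasDerivWithinAt g₁ (g₂ t) (Icc x y) t)
    (hd₂ : ∀ t ∈ Icc x y, HasDerivWithinAt g₂ (g₃ t) (Icc x y) t)
    (hg : ConvexOn ℝ (Icc x y) g₃) :
    (y - x) * ((g₁ x + g₁ y) / 2) - (y - x) ^ 3 * ((g₃ x + g₃ y) / 24) ≤ g y - g x := by
  set s := (g₃ y - g₃ x) / (y - x) with hs
  set a := g₃ x with ha
  have hsy : g₃ y = a + s * (y - x) := by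
    rw [hs, div_mul_cancel₀ _ (sub_pos.mpr hxy).ne']; ring
  have hlin : ∀ t, HasDerivAt (fun t => t - x) 1 t := fun t => (hasDerivAt_id t).sub_const x
  -- The subtracted quartic has the chord of g₃ as its third derivative. The remainder thus has
  -- nonpositive third derivative, hence concave first derivative, and the plain trapezoidal bound
  -- applies to it. The error of that rule on the quartic is exactly the correction term.
  have hr : ∀ t ∈ Icc x y, HasDerivWithinAt
      (fun t => g t - (a / 6 * (t - x) ^ 3 + s / 24 * (t - x) ^ 4))
      (g₁ t - (a / 2 * (t - x) ^ 2 + s / 6 * (t - x) ^ 3)) (Icc x y) t := by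
    intro t ht
    refine (hd t ht).sub (HasDerivAt.hasDerivWithinAt ?_)
    convert! (((hlin t).pow 3).const_mul (a / 6)).add (((hlin t).pow 4).const_mul (s / 24)) using 1
    norm_num; ring
  have hr₁ : ∀ t ∈ Icc x y, HasDerivWithinAt
      (fun t => g₁ t - (a / 2 * (t - x) ^ 2 + s / 6 * (t - x) ^ 3))
      (g₂ t - (a * (t - x) + s / 2 * (t - x) ^ 2)) (Icc x y) t := by
    intro t ht
    refine (hd₁ t ht).sub (HasDerivAt.hasDerivWithinAt ?_)
    convert! (((hlin t).pow 2).const_mul (a / 2)).add (((hlin t).pow 3).const_mul (s / 6)) using 1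
    norm_num; ring
  have hr₂ : ∀ t ∈ Icc x y, HasDerivWithinAt
      (fun t => g₂ t - (a * (t - x) + s / 2 * (t - x) ^ 2))
      (g₃ t - (a + (t - x) * s)) (Icc x y) t := by
    intro t ht
    refine (hd₂ t ht).sub (HasDerivAt.hasDerivWithinAt ?_)
    convert! ((hlin t).const_mul a).add (((hlin t).pow 2).const_mul (s / 2)) using 1
    norm_num; ring
  have hconc := concaveOn_of_hasDerivWithinAt2_nonpos (convex_Icc x y)
    (fun t ht => (hr₁ t ht).continuousWithinAt)
    (fun t ht => (hr₁ t (interior_subset ht)).mono interior_subset)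
    (fun t ht => (hr₂ t (interior_subset ht)).mono interior_subset)
    (fun t ht => sub_nonpos.mpr (hg.le_chord hxy (interior_subset ht)))
  have h := trapezoid_le_sub_of_concaveOn hxy hr hconc
  simp only [sub_self] at h
  rw [hsy]
  linarith

end Quadrature

/-! ### Polynomials and derivatives within an interval. -/

section Interval
open Set

theorem Set.OrdConnected.uniqueDiffOn_of_nontrivial {I : Set ℝ} (hI : I.OrdConnected)
    (h : I.Nontrivial) : UniqueDiffOn ℝ I :=
  uniqueDiffOn_convex hI.convex (hI.convex.nontrivial_iff_nonempty_interior.mp h)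

theorem Polynomial.exists_antiderivative (q : Polynomial ℝ) {k : ℕ} (hq : q.natDegree ≤ k) :
    ∃ p : Polynomial ℝ, p.natDegree ≤ k + 1 ∧ p.derivative = q := by
  refine ⟨∑ i ∈ Finset.range (k + 1), Polynomial.monomial (i + 1) (q.coeff i / (i + 1)), ?_, ?_⟩
  · refine Polynomial.natDegree_sum_le_of_forall_le _ _ fun i hi => ?_
    refine (Polynomial.natDegree_monomial_le _).trans ?_
    have := Finset.mem_range.mp hi
    omega
  · conv_rhs => rw [q.as_sum_range' (k + 1) (by omega)]
    rw [Polynomial.derivative_sum]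
    refine Finset.sum_congr rfl fun i _ => ?_
    rw [Polynomial.derivative_monomial]
    congr 1
    have : (i : ℝ) + 1 ≠ 0 := by positivity
    push_cast
    field_simp

theorem exists_polynomial_of_derivWithin {I : Set ℝ} (hI : I.OrdConnected) {F : ℝ → ℝ}
    (hF : DifferentiableOn ℝ F I) {q : Polynomial ℝ} {k : ℕ} (hq : q.natDegree ≤ k)
    (h : ∀ x ∈ I, derivWithin F I x = q.eval x) :
    ∃ p : Polynomial ℝ, p.natDegree ≤ k + 1 ∧ ∀ x ∈ I, F x = p.eval x := by
  rcases I.eq_empty_or_nonempty with rfl | ⟨x₀, hx₀⟩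
  · exact ⟨0, by simp, by simp⟩
  obtain ⟨p, hp, hpq⟩ := q.exists_antiderivative hq
  refine ⟨p + C (F x₀ - p.eval x₀), ?_, fun x hx => ?_⟩
  · rw [Polynomial.natDegree_add_C]; exact hp
  have hd : ∀ x ∈ I, HasDerivWithinAt (fun x => F x - p.eval x) 0 I x := by
    intro x hx
    have h1 := (hF x hx).hasDerivWithinAt.sub (p.hasDerivAt x).hasDerivWithinAt
    rwa [h x hx, hpq, sub_self] at h1
  have h2 := hI.convex.norm_image_sub_le_of_norm_hasDerivWithin_le (C := 0) hd
    (fun x _ => by simp) hx₀ hx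
  rw [zero_mul, norm_le_zero_iff, sub_eq_zero] at h2
  simp only [Polynomial.eval_add, Polynomial.eval_C]
  linarith

theorem iteratedDerivWithin_eq_eval {I : Set ℝ} (hI : UniqueDiffOn ℝ I) {F : ℝ → ℝ}
    {p : Polynomial ℝ} (h : ∀ x ∈ I, F x = p.eval x) (k : ℕ) :
    ∀ x ∈ I, iteratedDerivWithin k F I x = (Polynomial.derivative^[k] p).eval x := by
  induction k with
  | zero => simpa using h
  | succ k ih =>
    intro x hx
    rw [iteratedDerivWithin_succ, Function.iterate_succ_apply', derivWithin_congr ih (ih x hx)]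
    exact (Polynomial.hasDerivAt _ x).hasDerivWithinAt.derivWithin (hI x hx)

theorem exists_affine_iteratedDerivWithin {I : Set ℝ} (hI : I.OrdConnected) {F : ℝ → ℝ}
    {p : Polynomial ℝ} {k : ℕ} (hp : p.natDegree ≤ k + 1) (h : ∀ x ∈ I, F x = p.eval x) :
    ∃ a b : ℝ, ∀ x ∈ I, iteratedDerivWithin k F I x = a * x + b := by
  -- On a single point derivatives within I are not unique, but there any value is affine.
  rcases I.subsingleton_or_nontrivial with hs | hs
  · rcases hs.eq_empty_or_singleton with rfl | ⟨c, rfl⟩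
    · simp
    · exact ⟨0, iteratedDerivWithin k F {c} c, by simp⟩
  · have hq : (Polynomial.derivative^[k] p).natDegree ≤ 1 :=
      (p.natDegree_iterate_derivative k).trans (by omega)
    obtain ⟨a, b, hab⟩ := Polynomial.exists_eq_X_add_C_of_natDegree_le_one hq
    refine ⟨a, b, fun x hx => ?_⟩
    rw [iteratedDerivWithin_eq_eval (hI.uniqueDiffOn_of_nontrivial hs) h k x hx, hab]
    simp

theorem convexOn_and_concaveOn_of_affine {I : Set ℝ} (hI : I.OrdConnected) {g : ℝ → ℝ}
    (h : ∃ a b : ℝ, ∀ x ∈ I, g x = a * x + b) : ConvexOn ℝ I g ∧ ConcaveOn ℝ I g := by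
  obtain ⟨a, b, h⟩ := h
  have key : ∀ ⦃x⦄, x ∈ I → ∀ ⦃y⦄, y ∈ I → ∀ ⦃s t : ℝ⦄, 0 ≤ s → 0 ≤ t → s + t = 1 →
      g (s • x + t • y) = s • g x + t • g y := by
    intro x hx y hy s t hs ht hst
    rw [h _ (hI.convex hx hy hs ht hst), h x hx, h y hy]
    simp only [smul_eq_mul]
    linear_combination -b * hst
  exact ⟨⟨hI.convex, fun x hx y hy s t hs ht hst => (key hx hy hs ht hst).le⟩,
    ⟨hI.convex, fun x hx y hy s t hs ht hst => (key hx hy hs ht hst).ge⟩⟩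

end Interval

/-! ### Functions for which the quadrature rules are exact are polynomials. -/

section FunctionalEquations
open Set

/-- Combining the equations for (a, y), (b, y) and (a, b) eliminates the values of f and leaves
f'(y) as an affine function of y. -/
theorem exists_polynomial_of_trapezoid_eq {I : Set ℝ} (hI : I.OrdConnected) (hn : I.Nontrivial)
    {F : ℝ → ℝ} (hF : DifferentiableOn ℝ F I) (hf : DifferentiableOn ℝ (derivWithin F I) I)
    (h : ∀ x ∈ I, ∀ y ∈ I, derivWithin F I y - derivWithin F I x =
      (y - x) * ((derivWithin (derivWithin F I) I x + derivWithin (derivWithin F I) I y) / 2)) :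
    ∃ p : Polynomial ℝ, p.natDegree ≤ 3 ∧ ∀ x ∈ I, F x = p.eval x := by
  obtain ⟨a, ha, b, hb, hab⟩ := hn
  set f := derivWithin F I
  set f' := derivWithin f I
  have hab' : b - a ≠ 0 := sub_ne_zero.mpr hab.symm
  obtain ⟨q, hq, hfq⟩ := exists_polynomial_of_derivWithin hI hf (k := 1)
    (q := C ((f' b - f' a) / (b - a)) * X + C (f' a - (f' b - f' a) / (b - a) * a))
    Polynomial.natDegree_linear_le (by
      intro y hy
      have h1 := h a ha y hy
      have h2 := h b hb y hy
      have h3 := h a ha b hb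
      simp only [Polynomial.eval_add, Polynomial.eval_mul, Polynomial.eval_C, Polynomial.eval_X]
      change f' y = _
      field_simp
      linear_combination 2 * h2 - 2 * h1 + 2 * h3)
  exact exists_polynomial_of_derivWithin hI hF hq hfq

/-- After translating x to 0, the equation multiplies the coefficient of degree m > 3 by 1 - m/2 +
m(m-1)(m-2)/24. This factor is 0 at m = 4, but 1 at m = 5 and 3 at m = 6. -/
theorem Polynomial.natDegree_le_four_of_trapezoid_eq {P : Polynomial ℝ} (hP : P.natDegree ≤ 6)
    {S : Set ℝ} (hS : S.Infinite) {x : ℝ}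
    (h : ∀ y ∈ S, P.eval y - P.eval x =
      (y - x) * ((P.derivative.eval x + P.derivative.eval y) / 2) - (y - x) ^ 3 *
        ((P.derivative.derivative.derivative.eval x +
          P.derivative.derivative.derivative.eval y) / 24)) :
    P.natDegree ≤ 4 := by
  set Q := P.comp (X + C x) with hQ
  have hQn : Q.natDegree = P.natDegree := by
    rw [hQ, Polynomial.natDegree_comp, Polynomial.natDegree_X_add_C, mul_one]
  have hd : ∀ R : Polynomial ℝ, (R.comp (X + C x)).derivative = R.derivative.comp (X + C x) := by
    intro R; rw [Polynomial.derivative_comp]; simp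
  have hz : Q - C (P.eval x) - X * (C (P.derivative.eval x / 2) + C (1 / 2) * Q.derivative) +
      X ^ 3 * (C (P.derivative.derivative.derivative.eval x / 24) +
        C (1 / 24) * Q.derivative.derivative.derivative) = 0 := by
    refine Polynomial.eq_zero_of_infinite_isRoot _ ((hS.image (f := fun y => y - x)
      (sub_left_injective.injOn)).mono ?_)
    rintro _ ⟨y, hy, rfl⟩
    have h1 := h y hy
    simp only [mem_ofPred_eq, Polynomial.IsRoot.def, hQ, hd, Polynomial.eval_add,
      Polynomial.eval_sub, Polynomial.eval_mul, Polynomial.eval_C, Polynomial.eval_X,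
      Polynomial.eval_pow, Polynomial.eval_comp, sub_add_cancel]
    linear_combination h1
  have h5 := congrArg (fun R => Polynomial.coeff R 5) hz
  have h6 := congrArg (fun R => Polynomial.coeff R 6) hz
  simp [Polynomial.coeff_X_mul, Polynomial.coeff_X_pow_mul',
    Polynomial.coeff_derivative] at h5 h6
  rw [← hQn, Polynomial.natDegree_le_iff_coeff_eq_zero]
  intro N hN
  by_cases hN6 : 6 < N
  · exact Polynomial.coeff_eq_zero_of_natDegree_lt (by omega)
  · interval_cases N
    · linarith
    · linarith

/-- For fixed y the equation based at c says that a cubic `E c`, evaluated at y, is D₁(y) - (y-c)/2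
D₂(y) + (y-c)³/24 D₄(y). A third difference over four equally spaced c removes D₁ and D₂ and leaves
d³/4 times D₄(y). So D₄ is a cubic and D₁ has degree at most 6, which the previous lemma lowers to
4. -/
theorem exists_polynomial_of_corrected_trapezoid_eq {I : Set ℝ} (hI : I.OrdConnected)
    (hn : I.Nontrivial) {F : ℝ → ℝ}
    (hF : ∀ k < 4, DifferentiableOn ℝ (iteratedDerivWithin k F I) I)
    (h : ∀ x ∈ I, ∀ y ∈ I, iteratedDerivWithin 1 F I y - iteratedDerivWithin 1 F I x =
      (y - x) * ((iteratedDerivWithin 2 F I x + iteratedDerivWithin 2 F I y) / 2) -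
      (y - x) ^ 3 * ((iteratedDerivWithin 4 F I x + iteratedDerivWithin 4 F I y) / 24)) :
    ∃ p : Polynomial ℝ, p.natDegree ≤ 5 ∧ ∀ x ∈ I, F x = p.eval x := by
  have hud := hI.uniqueDiffOn_of_nontrivial hn
  obtain ⟨a, ha, b, hb, hab⟩ := hn.exists_lt
  set D := fun k => iteratedDerivWithin k F I with hD
  have hDs : ∀ k, derivWithin (D k) I = D (k + 1) := fun k => iteratedDerivWithin_succ.symm
  set d := (b - a) / 3 with hd
  have hd0 : 0 < d := by rw [hd]; linarith
  have hmem : ∀ i : ℝ, 0 ≤ i → i ≤ 3 → a + i * d ∈ I := fun i h0 h3 =>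
    hI.out ha hb ⟨by nlinarith, by nlinarith⟩
  set E : ℝ → Polynomial ℝ := fun c =>
    C (D 1 c) + (X - C c) * C (D 2 c / 2) - (X - C c) ^ 3 * C (D 4 c / 24) with hE
  have hEd : ∀ c, (E c).natDegree ≤ 3 := fun c => by
    refine (Polynomial.natDegree_sub_le_of_le (m := 3) (n := 3) ((Polynomial.natDegree_add_le_of_le
      (m := 0) (n := 1) (Polynomial.natDegree_C _).le ?_).trans (by norm_num)) ?_).trans le_rfl
    · exact (Polynomial.natDegree_mul_C_le _ _).trans (Polynomial.natDegree_X_sub_C c).le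
    · refine (Polynomial.natDegree_mul_C_le _ _).trans ?_
      rw [Polynomial.natDegree_pow, Polynomial.natDegree_X_sub_C]
  have hEe : ∀ c ∈ I, ∀ y ∈ I,
      (E c).eval y = D 1 y - (y - c) / 2 * D 2 y + (y - c) ^ 3 / 24 * D 4 y := by
    intro c hc y hy
    simp only [hE, Polynomial.eval_add, Polynomial.eval_sub, Polynomial.eval_mul,
      Polynomial.eval_C, Polynomial.eval_X, Polynomial.eval_pow]
    linear_combination -h c hc y hy
  obtain ⟨q₃, hq₃, h₃⟩ := exists_polynomial_of_derivWithin hI (hF 3 (by norm_num)) (k := 3)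
    (q := C (4 / d ^ 3) * (E (a + 0 * d) - C 3 * E (a + 1 * d) + C 3 * E (a + 2 * d) -
      E (a + 3 * d)))
    (by
      refine (Polynomial.natDegree_C_mul_le _ _).trans ?_
      refine (Polynomial.natDegree_sub_le_of_le (m := 3) (Polynomial.natDegree_add_le_of_degree_le
        ((Polynomial.natDegree_sub_le_of_le (m := 3) (n := 3) (hEd _) ?_).trans le_rfl) ?_)
        (hEd _)).trans le_rfl
      · exact (Polynomial.natDegree_C_mul_le _ _).trans (hEd _)
      · exact (Polynomial.natDegree_C_mul_le _ _).trans (hEd _))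
    (by
      intro y hy
      change derivWithin (D 3) I y = _
      rw [hDs]
      simp only [Polynomial.eval_add, Polynomial.eval_sub, Polynomial.eval_mul, Polynomial.eval_C]
      rw [hEe _ (hmem 0 le_rfl (by norm_num)) y hy, hEe _ (hmem 1 (by norm_num) (by norm_num)) y hy,
        hEe _ (hmem 2 (by norm_num) (by norm_num)) y hy,
        hEe _ (hmem 3 (by norm_num) le_rfl) y hy]
      field_simp
      ring)
  obtain ⟨q₂, hq₂, h₂⟩ := exists_polynomial_of_derivWithin hI (hF 2 (by norm_num)) hq₃
    (fun x hx => by rw [← iteratedDerivWithin_succ]; exact h₃ x hx)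
  obtain ⟨P, hP, h₁⟩ := exists_polynomial_of_derivWithin hI (hF 1 (by norm_num)) hq₂
    (fun x hx => by rw [← iteratedDerivWithin_succ]; exact h₂ x hx)
  have hit : ∀ k, ∀ x ∈ I, D (k + 1) x = (Polynomial.derivative^[k] P).eval x := by
    intro k x hx
    rw [← iteratedDerivWithin_eq_eval hud h₁ k x hx, iteratedDerivWithin_one,
      ← iteratedDerivWithin_succ']
  have hP4 : P.natDegree ≤ 4 := by
    refine Polynomial.natDegree_le_four_of_trapezoid_eq hP ((Icc_infinite hab).mono (hI.out ha hb))
      (x := a) fun y hy => ?_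
    have h1 := h a ha y hy
    have e : ∀ k, ∀ x ∈ I, iteratedDerivWithin (k + 1) F I x =
      (Polynomial.derivative^[k] P).eval x := hit
    rw [e 0 a ha, e 0 y hy, e 1 a ha, e 1 y hy, e 3 a ha, e 3 y hy] at h1
    exact h1
  have hF0 := hF 0 (by norm_num)
  rw [iteratedDerivWithin_zero] at hF0
  exact exists_polynomial_of_derivWithin hI hF0 hP4
    (fun x hx => by rw [← iteratedDerivWithin_one]; exact h₁ x hx)

end FunctionalEquations

/-! ### The second derivative of the trace, and the kernels of the comparison terms. -/

section SecondDerivative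
open Matrix

variable {n : ℕ}

/-- The weights are symmetric in j and k, so the one-sided kernel g(λ_k) can be averaged with
g(λ_j). -/
theorem Matrix.IsHermitian.trace_mul_cfc_mul {A B : Matrix (Fin n) (Fin n) ℂ}
    (hA : A.IsHermitian) (hB : B.IsHermitian) (g : ℝ → ℝ) :
    (B * cfc g A * B).trace.re = ∑ j, ∑ k, ‖hA.inEigenbasis B j k‖ ^ 2 *
      ((g (hA.eigenvalues j) + g (hA.eigenvalues k)) / 2) := by
  have h := hA.trace_cfc_mul_mul_cfc_mul g (fun _ => 1) hB
  have h1 : cfc (fun _ : ℝ => (1 : ℝ)) A = 1 := by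
    simpa using hA.cfc_pow_eq 0
  rw [h1, Matrix.mul_one, trace_mul_cycle, trace_mul_comm, ← Matrix.mul_assoc] at h
  have h2 : ∑ j, ∑ k, ‖hA.inEigenbasis B j k‖ ^ 2 * (g (hA.eigenvalues j) * 1) =
      ∑ j, ∑ k, ‖hA.inEigenbasis B j k‖ ^ 2 * (g (hA.eigenvalues k) * 1) := by
    rw [Finset.sum_comm]
    refine Finset.sum_congr rfl fun j _ => Finset.sum_congr rfl fun k _ => ?_
    rw [hA.norm_inEigenbasis_symm hB]
  have h3 : ∑ j, ∑ k, ‖hA.inEigenbasis B j k‖ ^ 2 *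
      ((g (hA.eigenvalues j) + g (hA.eigenvalues k)) / 2) =
      (∑ j, ∑ k, ‖hA.inEigenbasis B j k‖ ^ 2 * (g (hA.eigenvalues j) * 1) +
      ∑ j, ∑ k, ‖hA.inEigenbasis B j k‖ ^ 2 * (g (hA.eigenvalues k) * 1)) / 2 := by
    rw [← Finset.sum_add_distrib, Finset.sum_div]
    refine Finset.sum_congr rfl fun j _ => ?_
    rw [← Finset.sum_add_distrib, Finset.sum_div]
    exact Finset.sum_congr rfl fun k _ => by ring
  rw [h3, ← h2, ← h, trace_mul_cycle]
  ring

theorem Matrix.IsHermitian.inEigenbasis_lie {A : Matrix (Fin n) (Fin n) ℂ}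
    (hA : A.IsHermitian) (B : Matrix (Fin n) (Fin n) ℂ) (j k : Fin n) :
    hA.inEigenbasis ⁅A, B⁆ j k =
      ((hA.eigenvalues j - hA.eigenvalues k : ℝ) : ℂ) * hA.inEigenbasis B j k := by
  have h : hA.inEigenbasis ⁅A, B⁆ = hA.inEigenbasis A * hA.inEigenbasis B -
      hA.inEigenbasis B * hA.inEigenbasis A := by
    rw [← hA.inEigenbasis_mul, ← hA.inEigenbasis_mul, Ring.lie_def]
    simp [inEigenbasis, Matrix.mul_sub, Matrix.sub_mul]
  rw [h, hA.inEigenbasis_self, Matrix.sub_apply, diagonal_mul, mul_diagonal]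
  push_cast; ring

/-- The commutator has entries (λ_j - λ_k) b_jk. It is antihermitian, which produces the minus sign.
-/
theorem Matrix.IsHermitian.trace_cfc_mul_lie_sq {A B : Matrix (Fin n) (Fin n) ℂ}
    (hA : A.IsHermitian) (hB : B.IsHermitian) (g : ℝ → ℝ) :
    (cfc g A * ⁅A, B⁆ ^ 2).trace.re = ∑ j, ∑ k, ‖hA.inEigenbasis B j k‖ ^ 2 *
      (-(hA.eigenvalues j - hA.eigenvalues k) ^ 2 *
        ((g (hA.eigenvalues j) + g (hA.eigenvalues k)) / 2)) := by
  have h1 : (cfc g A * ⁅A, B⁆ ^ 2).trace.re = ∑ j, ∑ k, ‖hA.inEigenbasis B j k‖ ^ 2 *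
      (-(hA.eigenvalues j - hA.eigenvalues k) ^ 2 * g (hA.eigenvalues j)) := by
    rw [hA.trace_cfc_mul, Complex.re_sum]
    refine Finset.sum_congr rfl fun j _ => ?_
    rw [pow_two, hA.inEigenbasis_mul, Matrix.mul_apply, Finset.mul_sum, Complex.re_sum]
    refine Finset.sum_congr rfl fun k _ => ?_
    rw [hA.inEigenbasis_lie, hA.inEigenbasis_lie, ← Complex.ofReal_re (_ * _)]
    congr 1
    have := hA.inEigenbasis_mul_re hB j k
    push_cast at this ⊢
    rw [← this]; ring
  have h2 : (cfc g A * ⁅A, B⁆ ^ 2).trace.re = ∑ j, ∑ k, ‖hA.inEigenbasis B j k‖ ^ 2 *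
      (-(hA.eigenvalues j - hA.eigenvalues k) ^ 2 * g (hA.eigenvalues k)) := by
    rw [h1, Finset.sum_comm]
    refine Finset.sum_congr rfl fun j _ => Finset.sum_congr rfl fun k _ => ?_
    rw [hA.norm_inEigenbasis_symm hB]; ring
  have h3 : (cfc g A * ⁅A, B⁆ ^ 2).trace.re =
      ((cfc g A * ⁅A, B⁆ ^ 2).trace.re + (cfc g A * ⁅A, B⁆ ^ 2).trace.re) / 2 := by ring
  rw [h3]
  nth_rewrite 1 [h1]
  rw [h2, ← Finset.sum_add_distrib, Finset.sum_div]
  refine Finset.sum_congr rfl fun j _ => ?_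
  rw [← Finset.sum_add_distrib, Finset.sum_div]
  exact Finset.sum_congr rfl fun k _ => by ring

namespace IsAnalyticHermitianFamily

variable {T I : Set ℝ} {H : ℝ → Matrix (Fin n) (Fin n) ℂ} {F : ℝ → ℝ}

/-- The eigenvalue functions stay in I near τ, so one-sided derivatives of F at the endpoints
suffice for the chain rule. -/
theorem eventually_hasDerivAt_traceFun (hH : IsAnalyticHermitianFamily T I H) (hT : IsOpen T)
    (hF : DifferentiableOn ℝ F I) {τ : ℝ} (hτ : τ ∈ T) {ev : Fin n → ℝ → ℝ}
    (hev : IsAnalyticEigenvalueLabelling H τ ev) :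
    ∀ᶠ t in 𝓝 τ, HasDerivAt (traceFun F H)
      (∑ j, derivWithin F I (ev j t) * deriv (ev j) t) t := by
  have hev1 : ∀ᶠ t in 𝓝 τ, ∀ j, AnalyticAt ℝ (ev j) t :=
    Filter.eventually_all.mpr fun j => (hev.analytic j).eventually_analyticAt
  filter_upwards [(hH.eventually_sum_eq hT hτ hev F).eventuallyEq_nhds,
    (hH.eventually_mem hT hτ hev).eventually_nhds, hev1] with t h1 h2 h3
  refine HasDerivAt.congr_of_eventuallyEq ?_ h1
  exact HasDerivAt.fun_sum fun j _ =>
    (hF _ (h2.self_of_nhds j)).hasDerivWithinAt.comp_hasDerivAt t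
      (h3 j).differentiableAt.hasDerivAt (h2.mono fun s hs => hs j)

theorem hasDerivAt_deriv_traceFun (hH : IsAnalyticHermitianFamily T I H) (hT : IsOpen T)
    (hF : DifferentiableOn ℝ F I) (hf : DifferentiableOn ℝ (derivWithin F I) I) {τ : ℝ}
    (hτ : τ ∈ T) {ev : Fin n → ℝ → ℝ} (hev : IsAnalyticEigenvalueLabelling H τ ev) :
    HasDerivAt (deriv (traceFun F H))
      (∑ j, (derivWithin (derivWithin F I) I (ev j τ) * deriv (ev j) τ ^ 2 +
        derivWithin F I (ev j τ) * deriv (deriv (ev j)) τ)) τ := by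
  have h2 := hH.eventually_mem hT hτ hev
  have h := HasDerivAt.fun_sum (u := Finset.univ) fun j _ =>
    ((hf _ (h2.self_of_nhds j)).hasDerivWithinAt.comp_hasDerivAt τ
      (hev.analytic j).differentiableAt.hasDerivAt (h2.mono fun s hs => hs j)).mul
      (hev.analytic j).deriv.differentiableAt.hasDerivAt
  have h' := h.congr_of_eventuallyEq (f₁ := deriv (traceFun F H))
    ((hH.eventually_hasDerivAt_traceFun hT hF hτ hev).mono fun t ht => ht.deriv)
  convert! h' using 1
  exact Finset.sum_congr rfl fun j _ => by simp only [Function.comp]; ring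

theorem deriv_deriv_traceFun (hH : IsAnalyticHermitianFamily T I H) (hT : IsOpen T)
    (hF : DifferentiableOn ℝ F I) (hf : DifferentiableOn ℝ (derivWithin F I) I) {τ : ℝ}
    (hτ : τ ∈ T) (hA : (H τ).IsHermitian) :
    deriv (deriv (traceFun F H)) τ =
      (cfc (derivWithin F I) (H τ) * matDeriv (matDeriv H) τ).trace.re +
      ∑ j, ∑ k, ‖hA.inEigenbasis (matDeriv H τ) j k‖ ^ 2 *
        dividedDiff (derivWithin F I) (derivWithin (derivWithin F I) I)
          (hA.eigenvalues j) (hA.eigenvalues k) := by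
  obtain ⟨ev, hev⟩ := hH.exists_labelling hT hτ
  rw [(hH.hasDerivAt_deriv_traceFun hT hF hf hτ hev).deriv, hH.sum_deriv2_eq hT hτ hev hA]

theorem eigenvalues_mem (hH : IsAnalyticHermitianFamily T I H) {τ : ℝ} (hτ : τ ∈ T)
    (hA : (H τ).IsHermitian) (j : Fin n) : hA.eigenvalues j ∈ I :=
  hH.spectrum_subset τ hτ (hA.eigenvalues_mem_spectrum_real j)

/-- The identity with g₁ = 0 evaluates Σ f(λ)λ̈ alone, so Σ f'(λ)λ̇² remains as it stands and pairs
of equal eigenvalues contribute nothing to the double sum. -/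
theorem deriv_deriv_traceFun_eq_labelling (hH : IsAnalyticHermitianFamily T I H) (hT : IsOpen T)
    (hF : DifferentiableOn ℝ F I) (hf : DifferentiableOn ℝ (derivWithin F I) I) {τ : ℝ}
    (hτ : τ ∈ T) (hA : (H τ).IsHermitian) {ev : Fin n → ℝ → ℝ}
    (hev : IsAnalyticEigenvalueLabelling H τ ev) :
    deriv (deriv (traceFun F H)) τ =
      (cfc (derivWithin F I) (H τ) * matDeriv (matDeriv H) τ).trace.re +
      ∑ j, derivWithin (derivWithin F I) I (ev j τ) * deriv (ev j) τ ^ 2 +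
      ∑ j, ∑ k, ‖hA.inEigenbasis (matDeriv H τ) j k‖ ^ 2 *
        dividedDiff (derivWithin F I) 0 (hA.eigenvalues j) (hA.eigenvalues k) := by
  have h := hH.sum_deriv2_eq hT hτ hev hA (derivWithin F I) 0
  simp only [Pi.zero_apply, zero_mul, zero_add] at h
  rw [(hH.hasDerivAt_deriv_traceFun hT hF hf hτ hev).deriv, Finset.sum_add_distrib, h]
  ring

end IsAnalyticHermitianFamily

/-- The excess of the divided difference of `g` over the mean of `g₁`. -/
noncomputable def trapezoidDefect (g g₁ : ℝ → ℝ) (x y : ℝ) : ℝ :=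
  dividedDiff g g₁ x y - (g₁ x + g₁ y) / 2

/-- The excess of the divided difference of `g` over the mean of `g₁`, corrected by `g₃`. -/
noncomputable def correctedTrapezoidDefect (g g₁ g₃ : ℝ → ℝ) (x y : ℝ) : ℝ :=
  trapezoidDefect g g₁ x y + (x - y) ^ 2 * ((g₃ x + g₃ y) / 24)

theorem dividedDiff_symm (g g₁ : ℝ → ℝ) (x y : ℝ) :
    dividedDiff g g₁ x y = dividedDiff g g₁ y x := by
  unfold dividedDiff
  split_ifs with h h' h'
  · rw [h]
  · exact absurd h.symm h'
  · exact absurd h'.symm h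
  · rw [← neg_sub (g y), ← neg_sub y, neg_div_neg_eq]

theorem trapezoidDefect_symm (g g₁ : ℝ → ℝ) (x y : ℝ) :
    trapezoidDefect g g₁ x y = trapezoidDefect g g₁ y x := by
  rw [trapezoidDefect, trapezoidDefect, dividedDiff_symm, add_comm]

theorem trapezoidDefect_self (g g₁ : ℝ → ℝ) (x : ℝ) : trapezoidDefect g g₁ x x = 0 := by
  simp [trapezoidDefect, dividedDiff]

theorem correctedTrapezoidDefect_symm (g g₁ g₃ : ℝ → ℝ) (x y : ℝ) :
    correctedTrapezoidDefect g g₁ g₃ x y = correctedTrapezoidDefect g g₁ g₃ y x := by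
  rw [correctedTrapezoidDefect, correctedTrapezoidDefect, trapezoidDefect_symm]; ring

theorem correctedTrapezoidDefect_self (g g₁ g₃ : ℝ → ℝ) (x : ℝ) :
    correctedTrapezoidDefect g g₁ g₃ x x = 0 := by
  simp [correctedTrapezoidDefect, trapezoidDefect_self]

namespace IsAnalyticHermitianFamily

variable {T I : Set ℝ} {H : ℝ → Matrix (Fin n) (Fin n) ℂ} {F : ℝ → ℝ}

theorem deriv_deriv_traceFun_sub (hH : IsAnalyticHermitianFamily T I H) (hT : IsOpen T)
    (hF : DifferentiableOn ℝ F I) (hf : DifferentiableOn ℝ (derivWithin F I) I) {τ : ℝ}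
    (hτ : τ ∈ T) (hA : (H τ).IsHermitian) :
    deriv (deriv (traceFun F H)) τ -
      ((cfc (derivWithin F I) (H τ) * matDeriv (matDeriv H) τ).trace.re +
      (matDeriv H τ * cfc (derivWithin (derivWithin F I) I) (H τ) * matDeriv H τ).trace.re) =
      ∑ j, ∑ k, ‖hA.inEigenbasis (matDeriv H τ) j k‖ ^ 2 *
        trapezoidDefect (derivWithin F I) (derivWithin (derivWithin F I) I)
          (hA.eigenvalues j) (hA.eigenvalues k) := by
  rw [hH.deriv_deriv_traceFun hT hF hf hτ hA,
    hA.trace_mul_cfc_mul (hH.isHermitian_matDeriv hT hτ)]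
  simp only [trapezoidDefect, mul_sub, Finset.sum_sub_distrib]
  ring

theorem deriv_deriv_traceFun_sub' (hH : IsAnalyticHermitianFamily T I H) (hT : IsOpen T)
    (hF : DifferentiableOn ℝ F I) (hf : DifferentiableOn ℝ (derivWithin F I) I) {τ : ℝ}
    (hτ : τ ∈ T) (hA : (H τ).IsHermitian) (g : ℝ → ℝ) :
    deriv (deriv (traceFun F H)) τ -
      ((cfc (derivWithin F I) (H τ) * matDeriv (matDeriv H) τ).trace.re +
      (matDeriv H τ * cfc (derivWithin (derivWithin F I) I) (H τ) * matDeriv H τ).trace.re +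
      1 / 12 * (cfc g (H τ) * ⁅H τ, matDeriv H τ⁆ ^ 2).trace.re) =
      ∑ j, ∑ k, ‖hA.inEigenbasis (matDeriv H τ) j k‖ ^ 2 *
        correctedTrapezoidDefect (derivWithin F I) (derivWithin (derivWithin F I) I) g
          (hA.eigenvalues j) (hA.eigenvalues k) := by
  rw [← sub_sub, hH.deriv_deriv_traceFun_sub hT hF hf hτ hA,
    hA.trace_cfc_mul_lie_sq (hH.isHermitian_matDeriv hT hτ), Finset.mul_sum,
    ← Finset.sum_sub_distrib]
  refine Finset.sum_congr rfl fun j _ => ?_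
  rw [Finset.mul_sum, ← Finset.sum_sub_distrib]
  refine Finset.sum_congr rfl fun k _ => ?_
  rw [correctedTrapezoidDefect]; ring

/-- A weighted sum over pairs of eigenvalues is nonnegative if the summand is. -/
theorem sum_nonneg_of (hH : IsAnalyticHermitianFamily T I H) {τ : ℝ} (hτ : τ ∈ T)
    (hA : (H τ).IsHermitian) (B : Matrix (Fin n) (Fin n) ℂ) {δ : ℝ → ℝ → ℝ}
    (hδ : ∀ x ∈ I, ∀ y ∈ I, 0 ≤ δ x y) :
    0 ≤ ∑ j, ∑ k, ‖hA.inEigenbasis B j k‖ ^ 2 * δ (hA.eigenvalues j) (hA.eigenvalues k) :=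
  Finset.sum_nonneg fun j _ => Finset.sum_nonneg fun k _ => mul_nonneg (sq_nonneg _)
    (hδ _ (hH.eigenvalues_mem hτ hA j) _ (hH.eigenvalues_mem hτ hA k))

theorem sum_nonpos_of (hH : IsAnalyticHermitianFamily T I H) {τ : ℝ} (hτ : τ ∈ T)
    (hA : (H τ).IsHermitian) (B : Matrix (Fin n) (Fin n) ℂ) {δ : ℝ → ℝ → ℝ}
    (hδ : ∀ x ∈ I, ∀ y ∈ I, δ x y ≤ 0) :
    ∑ j, ∑ k, ‖hA.inEigenbasis B j k‖ ^ 2 * δ (hA.eigenvalues j) (hA.eigenvalues k) ≤ 0 :=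
  Finset.sum_nonpos fun j _ => Finset.sum_nonpos fun k _ => mul_nonpos_of_nonneg_of_nonpos
    (sq_nonneg _) (hδ _ (hH.eigenvalues_mem hτ hA j) _ (hH.eigenvalues_mem hτ hA k))

end IsAnalyticHermitianFamily

end SecondDerivative

/-! ### Signs of the kernels on I × I. -/

section Defects
open Set

variable {I : Set ℝ}

theorem dividedDiff_nonneg {g : ℝ → ℝ} (hg : MonotoneOn g I) :
    ∀ x ∈ I, ∀ y ∈ I, 0 ≤ dividedDiff g 0 x y := by
  intro x hx y hy
  unfold dividedDiff
  split_ifs with h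
  · simp
  · rcases le_total x y with hxy | hxy
    · exact div_nonneg_of_nonpos (sub_nonpos.mpr (hg hx hy hxy)) (sub_nonpos.mpr hxy)
    · exact div_nonneg (sub_nonneg.mpr (hg hy hx hxy)) (sub_nonneg.mpr hxy)

theorem dividedDiff_neg (g g₁ : ℝ → ℝ) (x y : ℝ) :
    dividedDiff (fun t => -g t) (fun t => -g₁ t) x y = -dividedDiff g g₁ x y := by
  unfold dividedDiff
  split_ifs <;> ring

theorem trapezoidDefect_neg (g g₁ : ℝ → ℝ) (x y : ℝ) :
    trapezoidDefect (fun t => -g t) (fun t => -g₁ t) x y = -trapezoidDefect g g₁ x y := by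
  rw [trapezoidDefect, dividedDiff_neg, trapezoidDefect]; ring

theorem correctedTrapezoidDefect_neg (g g₁ g₃ : ℝ → ℝ) (x y : ℝ) :
    correctedTrapezoidDefect (fun t => -g t) (fun t => -g₁ t) (fun t => -g₃ t) x y =
      -correctedTrapezoidDefect g g₁ g₃ x y := by
  rw [correctedTrapezoidDefect, trapezoidDefect_neg, correctedTrapezoidDefect]; ring

theorem dividedDiff_nonpos {g : ℝ → ℝ} (hg : AntitoneOn g I) :
    ∀ x ∈ I, ∀ y ∈ I, dividedDiff g 0 x y ≤ 0 := by
  intro x hx y hy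
  have h : 0 ≤ dividedDiff (fun t => -g t) 0 x y := dividedDiff_nonneg hg.neg x hx y hy
  have h' := dividedDiff_neg g 0 x y
  simp only [Pi.zero_apply, neg_zero] at h'
  have h0 : dividedDiff (fun t => -g t) 0 x y = dividedDiff (fun t => -g t) (fun _ => 0) x y := rfl
  linarith

theorem mul_dividedDiff_of_ne (g g₁ : ℝ → ℝ) {x y : ℝ} (h : x ≠ y) :
    (y - x) * dividedDiff g g₁ x y = g y - g x := by
  rw [dividedDiff_symm, dividedDiff, if_neg h.symm, mul_div_cancel₀ _ (sub_ne_zero.mpr h.symm)]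

theorem trapezoidDefect_nonpos {g g₁ : ℝ → ℝ} (hI : I.OrdConnected)
    (hd : ∀ t ∈ I, HasDerivWithinAt g (g₁ t) I t) (hg : ConvexOn ℝ I g₁) :
    ∀ x ∈ I, ∀ y ∈ I, trapezoidDefect g g₁ x y ≤ 0 := by
  have key : ∀ x ∈ I, ∀ y ∈ I, x < y → trapezoidDefect g g₁ x y ≤ 0 := by
    intro x hx y hy hxy
    have hs : Icc x y ⊆ I := hI.out hx hy
    have h := sub_le_trapezoid_of_convexOn hxy (fun t ht => (hd t (hs ht)).mono hs)
      (hg.subset hs (convex_Icc x y))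
    rw [← mul_dividedDiff_of_ne g g₁ hxy.ne, ← sub_nonpos, ← mul_sub] at h
    exact nonpos_of_mul_nonpos_right h (sub_pos.mpr hxy)
  intro x hx y hy
  rcases lt_trichotomy x y with h | rfl | h
  · exact key x hx y hy h
  · exact (trapezoidDefect_self _ _ _).le
  · rw [trapezoidDefect_symm]; exact key y hy x hx h

theorem trapezoidDefect_nonneg {g g₁ : ℝ → ℝ} (hI : I.OrdConnected)
    (hd : ∀ t ∈ I, HasDerivWithinAt g (g₁ t) I t) (hg : ConcaveOn ℝ I g₁) :
    ∀ x ∈ I, ∀ y ∈ I, 0 ≤ trapezoidDefect g g₁ x y := by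
  intro x hx y hy
  have h := trapezoidDefect_nonpos (g := fun t => -g t) (g₁ := fun t => -g₁ t) hI
    (fun t ht => (hd t ht).neg) hg.neg x hx y hy
  rw [trapezoidDefect_neg] at h
  linarith

/-- The derivatives are required only for nontrivial I, since on a single point only the diagonal
occurs, where the kernel is zero. -/
theorem correctedTrapezoidDefect_nonneg {g g₁ g₂ g₃ : ℝ → ℝ} (hI : I.OrdConnected)
    (hd : I.Nontrivial → ∀ t ∈ I, HasDerivWithinAt g (g₁ t) I t ∧ HasDerivWithinAt g₁ (g₂ t) I t ∧
      HasDerivWithinAt g₂ (g₃ t) I t) (hg : ConvexOn ℝ I g₃) :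
    ∀ x ∈ I, ∀ y ∈ I, 0 ≤ correctedTrapezoidDefect g g₁ g₃ x y := by
  have key : ∀ x ∈ I, ∀ y ∈ I, x < y → 0 ≤ correctedTrapezoidDefect g g₁ g₃ x y := by
    intro x hx y hy hxy
    have hs : Icc x y ⊆ I := hI.out hx hy
    have hd' := hd ⟨x, hx, y, hy, hxy.ne⟩
    have h := corrected_trapezoid_le_sub_of_convexOn hxy
      (fun t ht => (hd' t (hs ht)).1.mono hs) (fun t ht => (hd' t (hs ht)).2.1.mono hs)
      (fun t ht => (hd' t (hs ht)).2.2.mono hs) (hg.subset hs (convex_Icc x y))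
    rw [← mul_dividedDiff_of_ne g g₁ hxy.ne] at h
    refine nonneg_of_mul_nonneg_right (a := y - x) ?_ (sub_pos.mpr hxy)
    rw [correctedTrapezoidDefect, trapezoidDefect]
    linarith
  intro x hx y hy
  rcases lt_trichotomy x y with h | rfl | h
  · exact key x hx y hy h
  · exact (correctedTrapezoidDefect_self _ _ _ _).ge
  · rw [correctedTrapezoidDefect_symm]; exact key y hy x hx h

theorem correctedTrapezoidDefect_nonpos {g g₁ g₂ g₃ : ℝ → ℝ} (hI : I.OrdConnected)
    (hd : I.Nontrivial → ∀ t ∈ I, HasDerivWithinAt g (g₁ t) I t ∧ HasDerivWithinAt g₁ (g₂ t) I t ∧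
      HasDerivWithinAt g₂ (g₃ t) I t) (hg : ConcaveOn ℝ I g₃) :
    ∀ x ∈ I, ∀ y ∈ I, correctedTrapezoidDefect g g₁ g₃ x y ≤ 0 := by
  intro x hx y hy
  have h := correctedTrapezoidDefect_nonneg (g := fun t => -g t) (g₁ := fun t => -g₁ t)
    (g₂ := fun t => -g₂ t) (g₃ := fun t => -g₃ t) hI
    (fun hn t ht => ⟨(hd hn t ht).1.neg, (hd hn t ht).2.1.neg, (hd hn t ht).2.2.neg⟩)
    hg.neg x hx y hy
  rw [correctedTrapezoidDefect_neg] at h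
  linarith

end Defects

/-! ### A rotating two-eigenvalue family that detects the kernel. -/

section RotationFamily
open Matrix

variable {n : ℕ}

/-- The unit vector at angle `s` in the plane of two coordinate axes. -/
noncomputable def rotationVec (i₀ i₁ : Fin n) (s : ℝ) (i : Fin n) : ℝ :=
  if i = i₀ then Real.cos s else if i = i₁ then Real.sin s else 0

theorem sum_rotationVec_sq {i₀ i₁ : Fin n} (h : i₀ ≠ i₁) (s : ℝ) :
    ∑ i, rotationVec i₀ i₁ s i * rotationVec i₀ i₁ s i = 1 := by
  have h1 : ∀ i, rotationVec i₀ i₁ s i * rotationVec i₀ i₁ s i =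
      (if i = i₀ then Real.cos s ^ 2 else 0) + if i = i₁ then Real.sin s ^ 2 else 0 := by
    intro i
    unfold rotationVec
    split_ifs with h1 h2 h2
    · exact absurd (h1.symm.trans h2) h
    all_goals ring
  simp [h1, Finset.sum_add_distrib]

/-- The hermitian matrices with eigenvalue `y` on the line at angle `t - τ` and eigenvalue `x` on
its orthogonal complement. -/
noncomputable def rotationFamily (i₀ i₁ : Fin n) (τ x y t : ℝ) : Matrix (Fin n) (Fin n) ℂ :=
  Matrix.of fun i j => (((if i = j then x else 0) +
    (y - x) * (rotationVec i₀ i₁ (t - τ) i * rotationVec i₀ i₁ (t - τ) j) : ℝ) : ℂ)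

/-- The matrix is x + (y - x)P with P a projection, so (X - x)(X - y) annihilates it. -/
theorem spectrum_rotationFamily_subset {i₀ i₁ : Fin n} (h : i₀ ≠ i₁) (τ x y t : ℝ) :
    spectrum ℝ (rotationFamily i₀ i₁ τ x y t) ⊆ {x, y} := by
  have : Nonempty (Fin n) := ⟨i₀⟩
  set v := rotationVec i₀ i₁ (t - τ) with hv
  set P : Matrix (Fin n) (Fin n) ℂ := Matrix.of fun i j => ((v i * v j : ℝ) : ℂ) with hP
  have hPP : P * P = P := by
    ext i j
    rw [Matrix.mul_apply]
    simp only [hP, of_apply, ← Complex.ofReal_mul, ← Complex.ofReal_sum]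
    congr 1
    have h1 := sum_rotationVec_sq h (t - τ)
    calc ∑ k, v i * v k * (v k * v j) = v i * v j * ∑ k, v k * v k := by
          rw [Finset.mul_sum]; exact Finset.sum_congr rfl fun k _ => by ring
      _ = v i * v j := by rw [h1, mul_one]
  have hH : rotationFamily i₀ i₁ τ x y t = x • (1 : Matrix (Fin n) (Fin n) ℂ) + (y - x) • P := by
    ext i j
    by_cases hij : i = j
    · subst hij; simp [rotationFamily, hP, hv]
    · simp [rotationFamily, hP, hv, hij]
  intro μ hμ
  have h1 := spectrum.subset_polynomial_aeval (𝕜 := ℝ) (rotationFamily i₀ i₁ τ x y t)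
    ((X - C x) * (X - C y)) ⟨μ, hμ, rfl⟩
  have h2 : Polynomial.aeval (rotationFamily i₀ i₁ τ x y t) ((X - C x) * (X - C y)) = 0 := by
    have e1 : rotationFamily i₀ i₁ τ x y t - x • (1 : Matrix (Fin n) (Fin n) ℂ) =
        (y - x) • P := by rw [hH, add_sub_cancel_left]
    have e2 : rotationFamily i₀ i₁ τ x y t - y • (1 : Matrix (Fin n) (Fin n) ℂ) =
        (y - x) • (P - 1) := by rw [hH]; module
    simp only [map_mul, map_sub, Polynomial.aeval_X, Polynomial.aeval_C,
      Algebra.algebraMap_eq_smul_one]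
    rw [e1, e2, smul_mul_smul_comm, Matrix.mul_sub, hPP, Matrix.mul_one, sub_self, smul_zero]
  rw [h2, spectrum.zero_eq] at h1
  simpa [sub_eq_zero] using h1

theorem isAnalyticHermitianFamily_rotationFamily {i₀ i₁ : Fin n} (h : i₀ ≠ i₁) (T : Set ℝ)
    {I : Set ℝ} {x y : ℝ} (hx : x ∈ I) (hy : y ∈ I) (τ : ℝ) :
    IsAnalyticHermitianFamily T I (rotationFamily i₀ i₁ τ x y) where
  analytic i j := by
    intro t _
    have hv : ∀ i, AnalyticAt ℝ (fun t => rotationVec i₀ i₁ (t - τ) i) t := by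
      intro i
      have hs : AnalyticAt ℝ (fun t : ℝ => t - τ) t := analyticAt_id.sub analyticAt_const
      unfold rotationVec
      split_ifs
      · exact AnalyticAt.comp (g := Real.cos) Real.analyticAt_cos hs
      · exact AnalyticAt.comp (g := Real.sin) Real.analyticAt_sin hs
      · exact analyticAt_const
    exact (Complex.ofRealCLM.analyticAt _).comp
      (analyticAt_const.add (analyticAt_const.mul ((hv i).mul (hv j))))
  hermitian t _ := by
    ext i j
    simp only [rotationFamily, conjTranspose_apply, of_apply, Complex.star_def, Complex.conj_ofReal]
    by_cases hij : i = j
    · subst hij; rfl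
    · simp [hij, Ne.symm hij, mul_comm]
  spectrum_subset t _ := (spectrum_rotationFamily_subset h τ x y t).trans
    (by rintro z (rfl | rfl) <;> assumption)

/-- For x ≠ y this entry shows that H and Ḣ do not commute at τ, without having to identify the
chosen eigenbasis. -/
theorem lie_rotationFamily_apply {i₀ i₁ : Fin n} (h : i₀ ≠ i₁) (τ x y : ℝ) :
    ⁅rotationFamily i₀ i₁ τ x y τ, matDeriv (rotationFamily i₀ i₁ τ x y) τ⁆ i₀ i₁ =
      (((y - x) ^ 2 : ℝ) : ℂ) := by
  have h1 : rotationFamily i₀ i₁ τ x y τ =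
      diagonal fun i => ((x + if i = i₀ then y - x else 0 : ℝ) : ℂ) := by
    ext i j
    by_cases hij : i = j
    · subst hij
      simp only [rotationFamily, rotationVec, of_apply, diagonal_apply_eq]
      split_ifs <;> simp
    · simp only [rotationFamily, rotationVec, of_apply, diagonal_apply_ne _ hij, if_neg hij]
      split_ifs with a b <;> simp_all
  have h2 : matDeriv (rotationFamily i₀ i₁ τ x y) τ i₀ i₁ = ((y - x : ℝ) : ℂ) := by
    simp only [matDeriv, rotationFamily, of_apply]
    have hs : HasDerivAt (fun t : ℝ => t - τ) 1 τ := (hasDerivAt_id τ).sub_const τ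
    have h3 := ((hs.cos.mul hs.sin).const_mul (y - x)).const_add 0
    have h4 := h3.ofReal_comp.deriv
    simp only [sub_self, Real.cos_zero, Real.sin_zero] at h4
    simp only [rotationVec, if_neg h, if_neg h.symm, if_true]
    refine h4.trans ?_
    norm_num
  rw [Ring.lie_def, Matrix.sub_apply, h1, diagonal_mul, mul_diagonal, h2]
  simp only [if_true, if_neg h.symm]
  push_cast; ring

/-- For the rotating family δ takes the single value δ x y on all pairs of distinct eigenvalues, so
the sum is δ x y times a sum of nonnegative weights. Were those weights all zero, H and Ḣ would
commute at τ. -/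
theorem eq_zero_of_forall_family (hn : 2 ≤ n) {T I : Set ℝ} (hT : T.Nonempty) {δ : ℝ → ℝ → ℝ}
    (hsymm : ∀ x y, δ x y = δ y x) (hself : ∀ x, δ x x = 0)
    (h : ∀ H : ℝ → Matrix (Fin n) (Fin n) ℂ, IsAnalyticHermitianFamily T I H → ∀ τ ∈ T,
      ∀ hA : (H τ).IsHermitian, ∑ j, ∑ k, ‖hA.inEigenbasis (matDeriv H τ) j k‖ ^ 2 *
        δ (hA.eigenvalues j) (hA.eigenvalues k) = 0) :
    ∀ x ∈ I, ∀ y ∈ I, δ x y = 0 := by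
  intro x hx y hy
  by_cases hxy : x = y
  · rw [hxy, hself]
  obtain ⟨τ, hτ⟩ := hT
  set i₀ : Fin n := ⟨0, by omega⟩
  set i₁ : Fin n := ⟨1, by omega⟩
  have hi : i₀ ≠ i₁ := by simp [i₀, i₁]
  have hH := isAnalyticHermitianFamily_rotationFamily hi T hx hy τ
  set H := rotationFamily i₀ i₁ τ x y with hHdef
  have hA := hH.hermitian τ hτ
  have h0 := h H hH τ hτ hA
  have hev : ∀ j, hA.eigenvalues j = x ∨ hA.eigenvalues j = y := fun j =>
    spectrum_rotationFamily_subset hi τ x y τ (hA.eigenvalues_mem_spectrum_real j)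
  have hterm : ∀ j k, δ (hA.eigenvalues j) (hA.eigenvalues k) =
      δ x y * if hA.eigenvalues j = hA.eigenvalues k then 0 else 1 := by
    intro j k
    split_ifs with hjk
    · rw [hjk, hself, mul_zero]
    · rw [mul_one]
      rcases hev j with hj | hj <;> rcases hev k with hk | hk <;> rw [hj, hk] at hjk ⊢
      · exact absurd rfl hjk
      · exact hsymm y x
      · exact absurd rfl hjk
  by_contra hδ
  have hsum : ∑ j, ∑ k, ‖hA.inEigenbasis (matDeriv H τ) j k‖ ^ 2 *
      (if hA.eigenvalues j = hA.eigenvalues k then (0 : ℝ) else 1) = 0 := by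
    apply (mul_eq_zero.mp _).resolve_left hδ
    refine Eq.trans ?_ h0
    rw [Finset.mul_sum]
    refine Finset.sum_congr rfl fun j _ => ?_
    rw [Finset.mul_sum]
    exact Finset.sum_congr rfl fun k _ => by rw [hterm]; ring
  have hnn : ∀ j k, 0 ≤ ‖hA.inEigenbasis (matDeriv H τ) j k‖ ^ 2 *
      (if hA.eigenvalues j = hA.eigenvalues k then (0 : ℝ) else 1) := fun j k =>
    mul_nonneg (sq_nonneg _) (by split_ifs <;> norm_num)
  have hlie : hA.inEigenbasis ⁅H τ, matDeriv H τ⁆ = 0 := by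
    ext j k
    rw [hA.inEigenbasis_lie, Matrix.zero_apply]
    by_cases hjk : hA.eigenvalues j = hA.eigenvalues k
    · simp [hjk]
    · have h1 := (Finset.sum_eq_zero_iff_of_nonneg fun j _ =>
        Finset.sum_nonneg fun k _ => hnn j k).mp hsum j (Finset.mem_univ j)
      have h2 := (Finset.sum_eq_zero_iff_of_nonneg fun k _ => hnn j k).mp h1 k (Finset.mem_univ k)
      rw [if_neg hjk, mul_one] at h2
      rw [norm_eq_zero.mp (pow_eq_zero_iff two_ne_zero |>.mp h2), mul_zero]
  have hlie0 : ⁅H τ, matDeriv H τ⁆ = 0 := by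
    have hU : hA.eigenvectorUnitary.1 * (hA.eigenvectorUnitary.1)ᴴ = 1 :=
      Unitary.coe_mul_star_self hA.eigenvectorUnitary
    have h1 : hA.eigenvectorUnitary.1 * hA.inEigenbasis ⁅H τ, matDeriv H τ⁆ *
        (hA.eigenvectorUnitary.1)ᴴ = ⁅H τ, matDeriv H τ⁆ := by
      rw [Matrix.IsHermitian.inEigenbasis]
      simp only [Matrix.mul_assoc, hU, Matrix.mul_one]
      rw [← Matrix.mul_assoc, hU, Matrix.one_mul]
    rw [← h1, hlie, Matrix.mul_zero, Matrix.zero_mul]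
  have hentry := lie_rotationFamily_apply hi τ x y
  rw [← hHdef, hlie0, Matrix.zero_apply] at hentry
  have h1 : (y - x) ^ 2 = 0 := by exact_mod_cast hentry.symm
  exact hxy (sub_eq_zero.mp (pow_eq_zero_iff two_ne_zero |>.mp h1)).symm

end RotationFamily

/-! ### Assembly of the three statements. -/

theorem ContDiffOn.iteratedDerivWithin_hasDerivWithinAt {I : Set ℝ} (hI : UniqueDiffOn ℝ I)
    {F : ℝ → ℝ} (hF : ContDiffOn ℝ 4 F I) {k : ℕ} (hk : k < 4) {t : ℝ} (ht : t ∈ I) :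
    HasDerivWithinAt (iteratedDerivWithin k F I) (iteratedDerivWithin (k + 1) F I t) I t := by
  rw [iteratedDerivWithin_succ]
  exact (hF.differentiableOn_iteratedDerivWithin (by exact_mod_cast hk) hI t ht).hasDerivWithinAt

theorem mainTheorem4 (n : ℕ) (T I : Set ℝ) (hTo : IsOpen T) (hTc : T.OrdConnected)
    (hTn : T.Nonempty) (hI : I.OrdConnected) (F : ℝ → ℝ)
    (hF : DifferentiableOn ℝ F I) (hf : DifferentiableOn ℝ (derivWithin F I) I) :
    -- the quantities in the inequalities below exist
    (∀ H : ℝ → Matrix (Fin n) (Fin n) ℂ, IsAnalyticHermitianFamily T I H → ∀ τ ∈ T,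
      DifferentiableAt ℝ (traceFun F H) τ ∧
      DifferentiableAt ℝ (deriv (traceFun F H)) τ ∧
      ∃ ev : Fin n → ℝ → ℝ, IsAnalyticEigenvalueLabelling H τ ev) ∧
    -- first statement: convex case
    (ConvexOn ℝ I F → ∀ H : ℝ → Matrix (Fin n) (Fin n) ℂ, IsAnalyticHermitianFamily T I H →
      (∀ τ ∈ T, ∀ ev : Fin n → ℝ → ℝ, IsAnalyticEigenvalueLabelling H τ ev →
        deriv (deriv (traceFun F H)) τ ≥
          (cfc (derivWithin F I) (H τ) * matDeriv (matDeriv H) τ).trace.re +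
          ∑ j, derivWithin (derivWithin F I) I (ev j τ) * (deriv (ev j) τ) ^ 2) ∧
      ((∀ τ ∈ T, matDeriv (matDeriv H) τ = 0) → ConvexOn ℝ T (traceFun F H))) ∧
    -- first statement: concave case
    (ConcaveOn ℝ I F → ∀ H : ℝ → Matrix (Fin n) (Fin n) ℂ, IsAnalyticHermitianFamily T I H →
      (∀ τ ∈ T, ∀ ev : Fin n → ℝ → ℝ, IsAnalyticEigenvalueLabelling H τ ev →
        deriv (deriv (traceFun F H)) τ ≤
          (cfc (derivWithin F I) (H τ) * matDeriv (matDeriv H) τ).trace.re +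
          ∑ j, derivWithin (derivWithin F I) I (ev j τ) * (deriv (ev j) τ) ^ 2) ∧
      ((∀ τ ∈ T, matDeriv (matDeriv H) τ = 0) → ConcaveOn ℝ T (traceFun F H))) ∧
    -- first statement: equality for affine functions
    ((∃ a b : ℝ, ∀ x ∈ I, F x = a * x + b) →
      ∀ H : ℝ → Matrix (Fin n) (Fin n) ℂ, IsAnalyticHermitianFamily T I H →
      ∀ τ ∈ T, ∀ ev : Fin n → ℝ → ℝ, IsAnalyticEigenvalueLabelling H τ ev →
        deriv (deriv (traceFun F H)) τ =
          (cfc (derivWithin F I) (H τ) * matDeriv (matDeriv H) τ).trace.re +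
          ∑ j, derivWithin (derivWithin F I) I (ev j τ) * (deriv (ev j) τ) ^ 2) ∧
    -- second statement: convex case
    (ConvexOn ℝ I (derivWithin (derivWithin F I) I) →
      ∀ H : ℝ → Matrix (Fin n) (Fin n) ℂ, IsAnalyticHermitianFamily T I H → ∀ τ ∈ T,
        deriv (deriv (traceFun F H)) τ ≤
          (cfc (derivWithin F I) (H τ) * matDeriv (matDeriv H) τ).trace.re +
          (matDeriv H τ * cfc (derivWithin (derivWithin F I) I) (H τ) * matDeriv H τ).trace.re) ∧
    -- second statement: concave case
    (ConcaveOn ℝ I (derivWithin (derivWithin F I) I) →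
      ∀ H : ℝ → Matrix (Fin n) (Fin n) ℂ, IsAnalyticHermitianFamily T I H → ∀ τ ∈ T,
        deriv (deriv (traceFun F H)) τ ≥
          (cfc (derivWithin F I) (H τ) * matDeriv (matDeriv H) τ).trace.re +
          (matDeriv H τ * cfc (derivWithin (derivWithin F I) I) (H τ) * matDeriv H τ).trace.re) ∧
    -- second statement: polynomials of degree at most three give equality
    ((∃ p : Polynomial ℝ, p.natDegree ≤ 3 ∧ ∀ x ∈ I, F x = p.eval x) →
      ∀ H : ℝ → Matrix (Fin n) (Fin n) ℂ, IsAnalyticHermitianFamily T I H → ∀ τ ∈ T,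
        deriv (deriv (traceFun F H)) τ =
          (cfc (derivWithin F I) (H τ) * matDeriv (matDeriv H) τ).trace.re +
          (matDeriv H τ * cfc (derivWithin (derivWithin F I) I) (H τ) * matDeriv H τ).trace.re) ∧
    -- second statement: equality for all families only for such polynomials
    (2 ≤ n →
      (ConvexOn ℝ I (derivWithin (derivWithin F I) I) ∨
        ConcaveOn ℝ I (derivWithin (derivWithin F I) I)) →
      (∀ H : ℝ → Matrix (Fin n) (Fin n) ℂ, IsAnalyticHermitianFamily T I H → ∀ τ ∈ T,
        deriv (deriv (traceFun F H)) τ =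
          (cfc (derivWithin F I) (H τ) * matDeriv (matDeriv H) τ).trace.re +
          (matDeriv H τ * cfc (derivWithin (derivWithin F I) I) (H τ) * matDeriv H τ).trace.re) →
      ∃ p : Polynomial ℝ, p.natDegree ≤ 3 ∧ ∀ x ∈ I, F x = p.eval x) ∧
    -- third statement: convex case
    (ContDiffOn ℝ 4 F I → ConvexOn ℝ I (iteratedDerivWithin 4 F I) →
      ∀ H : ℝ → Matrix (Fin n) (Fin n) ℂ, IsAnalyticHermitianFamily T I H → ∀ τ ∈ T,
        deriv (deriv (traceFun F H)) τ ≥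
          (cfc (derivWithin F I) (H τ) * matDeriv (matDeriv H) τ).trace.re +
          (matDeriv H τ * cfc (derivWithin (derivWithin F I) I) (H τ) * matDeriv H τ).trace.re +
          1 / 12 * (cfc (iteratedDerivWithin 4 F I) (H τ) * ⁅H τ, matDeriv H τ⁆ ^ 2).trace.re) ∧
    -- third statement: concave case
    (ContDiffOn ℝ 4 F I → ConcaveOn ℝ I (iteratedDerivWithin 4 F I) →
      ∀ H : ℝ → Matrix (Fin n) (Fin n) ℂ, IsAnalyticHermitianFamily T I H → ∀ τ ∈ T,
        deriv (deriv (traceFun F H)) τ ≤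
          (cfc (derivWithin F I) (H τ) * matDeriv (matDeriv H) τ).trace.re +
          (matDeriv H τ * cfc (derivWithin (derivWithin F I) I) (H τ) * matDeriv H τ).trace.re +
          1 / 12 * (cfc (iteratedDerivWithin 4 F I) (H τ) * ⁅H τ, matDeriv H τ⁆ ^ 2).trace.re) ∧
    -- third statement: polynomials of degree at most five give equality
    ((∃ p : Polynomial ℝ, p.natDegree ≤ 5 ∧ ∀ x ∈ I, F x = p.eval x) →
      ∀ H : ℝ → Matrix (Fin n) (Fin n) ℂ, IsAnalyticHermitianFamily T I H → ∀ τ ∈ T,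
        deriv (deriv (traceFun F H)) τ =
          (cfc (derivWithin F I) (H τ) * matDeriv (matDeriv H) τ).trace.re +
          (matDeriv H τ * cfc (derivWithin (derivWithin F I) I) (H τ) * matDeriv H τ).trace.re +
          1 / 12 * (cfc (iteratedDerivWithin 4 F I) (H τ) * ⁅H τ, matDeriv H τ⁆ ^ 2).trace.re) ∧
    -- third statement: equality for all families only for such polynomials
    (2 ≤ n → ContDiffOn ℝ 4 F I →
      (ConvexOn ℝ I (iteratedDerivWithin 4 F I) ∨ ConcaveOn ℝ I (iteratedDerivWithin 4 F I)) →
      (∀ H : ℝ → Matrix (Fin n) (Fin n) ℂ, IsAnalyticHermitianFamily T I H → ∀ τ ∈ T,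
        deriv (deriv (traceFun F H)) τ =
          (cfc (derivWithin F I) (H τ) * matDeriv (matDeriv H) τ).trace.re +
          (matDeriv H τ * cfc (derivWithin (derivWithin F I) I) (H τ) * matDeriv H τ).trace.re +
          1 / 12 * (cfc (iteratedDerivWithin 4 F I) (H τ) * ⁅H τ, matDeriv H τ⁆ ^ 2).trace.re) →
      ∃ p : Polynomial ℝ, p.natDegree ≤ 5 ∧ ∀ x ∈ I, F x = p.eval x) := by
  have h2 : derivWithin (derivWithin F I) I = iteratedDerivWithin 2 F I := by
    rw [iteratedDerivWithin_succ, iteratedDerivWithin_one]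
  have hder : ContDiffOn ℝ 4 F I → I.Nontrivial → ∀ t ∈ I,
      HasDerivWithinAt (derivWithin F I) (derivWithin (derivWithin F I) I t) I t ∧
      HasDerivWithinAt (derivWithin (derivWithin F I) I) (iteratedDerivWithin 3 F I t) I t ∧
      HasDerivWithinAt (iteratedDerivWithin 3 F I) (iteratedDerivWithin 4 F I t) I t := by
    intro hC hn t ht
    have hud := hI.uniqueDiffOn_of_nontrivial hn
    refine ⟨(hf t ht).hasDerivWithinAt, ?_, ?_⟩
    · rw [h2]; exact hC.iteratedDerivWithin_hasDerivWithinAt hud (by norm_num) ht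
    · exact hC.iteratedDerivWithin_hasDerivWithinAt hud (by norm_num) ht
  have hf' : ∀ t ∈ I, HasDerivWithinAt (derivWithin F I)
      (derivWithin (derivWithin F I) I t) I t := fun t ht => (hf t ht).hasDerivWithinAt
  have diff : ∀ H : ℝ → Matrix (Fin n) (Fin n) ℂ, IsAnalyticHermitianFamily T I H → ∀ τ ∈ T,
      DifferentiableAt ℝ (traceFun F H) τ ∧ DifferentiableAt ℝ (deriv (traceFun F H)) τ := by
    intro H hH τ hτ
    obtain ⟨ev, hev⟩ := hH.exists_labelling hTo hτ
    exact ⟨(hH.eventually_hasDerivAt_traceFun hTo hF hτ hev).self_of_nhds.differentiableAt,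
      (hH.hasDerivAt_deriv_traceFun hTo hF hf hτ hev).differentiableAt⟩
  have convex₁ : ConvexOn ℝ I F → ∀ H : ℝ → Matrix (Fin n) (Fin n) ℂ,
      IsAnalyticHermitianFamily T I H → ∀ τ ∈ T, ∀ ev : Fin n → ℝ → ℝ,
      IsAnalyticEigenvalueLabelling H τ ev → deriv (deriv (traceFun F H)) τ ≥
          (cfc (derivWithin F I) (H τ) * matDeriv (matDeriv H) τ).trace.re +
          ∑ j, derivWithin (derivWithin F I) I (ev j τ) * (deriv (ev j) τ) ^ 2 := by
    intro hc H hH τ hτ ev hev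
    have hA := hH.hermitian τ hτ
    have h := hH.sum_nonneg_of hτ hA (matDeriv H τ)
      (dividedDiff_nonneg (hc.monotoneOn_derivWithin hF))
    have e := hH.deriv_deriv_traceFun_eq_labelling hTo hF hf hτ hA hev
    linarith
  have concave₁ : ConcaveOn ℝ I F → ∀ H : ℝ → Matrix (Fin n) (Fin n) ℂ,
      IsAnalyticHermitianFamily T I H → ∀ τ ∈ T, ∀ ev : Fin n → ℝ → ℝ,
      IsAnalyticEigenvalueLabelling H τ ev → deriv (deriv (traceFun F H)) τ ≤
          (cfc (derivWithin F I) (H τ) * matDeriv (matDeriv H) τ).trace.re +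
          ∑ j, derivWithin (derivWithin F I) I (ev j τ) * (deriv (ev j) τ) ^ 2 := by
    intro hc H hH τ hτ ev hev
    have hA := hH.hermitian τ hτ
    have h := hH.sum_nonpos_of hτ hA (matDeriv H τ)
      (dividedDiff_nonpos (hc.antitoneOn_derivWithin hF))
    have e := hH.deriv_deriv_traceFun_eq_labelling hTo hF hf hτ hA hev
    linarith
  have convex₂ : ConvexOn ℝ I (derivWithin (derivWithin F I) I) →
      ∀ H : ℝ → Matrix (Fin n) (Fin n) ℂ, IsAnalyticHermitianFamily T I H → ∀ τ ∈ T,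
        deriv (deriv (traceFun F H)) τ ≤
          (cfc (derivWithin F I) (H τ) * matDeriv (matDeriv H) τ).trace.re +
          (matDeriv H τ * cfc (derivWithin (derivWithin F I) I) (H τ) *
            matDeriv H τ).trace.re := by
    intro hc H hH τ hτ
    have hA := hH.hermitian τ hτ
    have h := hH.sum_nonpos_of hτ hA (matDeriv H τ) (trapezoidDefect_nonpos hI hf' hc)
    rw [← hH.deriv_deriv_traceFun_sub hTo hF hf hτ hA] at h
    linarith
  have concave₂ : ConcaveOn ℝ I (derivWithin (derivWithin F I) I) →
      ∀ H : ℝ → Matrix (Fin n) (Fin n) ℂ, IsAnalyticHermitianFamily T I H → ∀ τ ∈ T,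
        deriv (deriv (traceFun F H)) τ ≥
          (cfc (derivWithin F I) (H τ) * matDeriv (matDeriv H) τ).trace.re +
          (matDeriv H τ * cfc (derivWithin (derivWithin F I) I) (H τ) *
            matDeriv H τ).trace.re := by
    intro hc H hH τ hτ
    have hA := hH.hermitian τ hτ
    have h := hH.sum_nonneg_of hτ hA (matDeriv H τ) (trapezoidDefect_nonneg hI hf' hc)
    rw [← hH.deriv_deriv_traceFun_sub hTo hF hf hτ hA] at h
    linarith
  have convex₃ : ContDiffOn ℝ 4 F I → ConvexOn ℝ I (iteratedDerivWithin 4 F I) →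
      ∀ H : ℝ → Matrix (Fin n) (Fin n) ℂ, IsAnalyticHermitianFamily T I H → ∀ τ ∈ T,
        deriv (deriv (traceFun F H)) τ ≥
          (cfc (derivWithin F I) (H τ) * matDeriv (matDeriv H) τ).trace.re +
          (matDeriv H τ * cfc (derivWithin (derivWithin F I) I) (H τ) * matDeriv H τ).trace.re +
          1 / 12 * (cfc (iteratedDerivWithin 4 F I) (H τ) *
            ⁅H τ, matDeriv H τ⁆ ^ 2).trace.re := by
    intro hC hc H hH τ hτ
    have hA := hH.hermitian τ hτ
    have h := hH.sum_nonneg_of hτ hA (matDeriv H τ)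
      (correctedTrapezoidDefect_nonneg hI (hder hC) hc)
    rw [← hH.deriv_deriv_traceFun_sub' hTo hF hf hτ hA] at h
    linarith
  have concave₃ : ContDiffOn ℝ 4 F I → ConcaveOn ℝ I (iteratedDerivWithin 4 F I) →
      ∀ H : ℝ → Matrix (Fin n) (Fin n) ℂ, IsAnalyticHermitianFamily T I H → ∀ τ ∈ T,
        deriv (deriv (traceFun F H)) τ ≤
          (cfc (derivWithin F I) (H τ) * matDeriv (matDeriv H) τ).trace.re +
          (matDeriv H τ * cfc (derivWithin (derivWithin F I) I) (H τ) * matDeriv H τ).trace.re +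
          1 / 12 * (cfc (iteratedDerivWithin 4 F I) (H τ) *
            ⁅H τ, matDeriv H τ⁆ ^ 2).trace.re := by
    intro hC hc H hH τ hτ
    have hA := hH.hermitian τ hτ
    have h := hH.sum_nonpos_of hτ hA (matDeriv H τ)
      (correctedTrapezoidDefect_nonpos hI (hder hC) hc)
    rw [← hH.deriv_deriv_traceFun_sub' hTo hF hf hτ hA] at h
    linarith
  refine ⟨?_, ?_, ?_, ?_, convex₂, concave₂, ?_, ?_, convex₃, concave₃, ?_, ?_⟩
  · exact fun H hH τ hτ =>
      ⟨(diff H hH τ hτ).1, (diff H hH τ hτ).2, hH.exists_labelling hTo hτ⟩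
  · refine fun hc H hH => ⟨convex₁ hc H hH, fun h0 => ?_⟩
    refine convexOn_of_deriv2_nonneg' hTc.convex
      (fun τ hτ => (diff H hH τ hτ).1.differentiableWithinAt)
      (fun τ hτ => (diff H hH τ hτ).2.differentiableWithinAt) fun τ hτ => ?_
    obtain ⟨ev, hev⟩ := hH.exists_labelling hTo hτ
    have h := convex₁ hc H hH τ hτ ev hev
    rw [h0 τ hτ, Matrix.mul_zero, Matrix.trace_zero, Complex.zero_re, zero_add] at h
    refine le_trans (Finset.sum_nonneg fun j _ => mul_nonneg ?_ (sq_nonneg _)) h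
    -- Convexity makes f monotone, hence f' ≥ 0.
    exact (hc.monotoneOn_derivWithin hF).derivWithin_nonneg
  · refine fun hc H hH => ⟨concave₁ hc H hH, fun h0 => ?_⟩
    refine concaveOn_of_deriv2_nonpos' hTc.convex
      (fun τ hτ => (diff H hH τ hτ).1.differentiableWithinAt)
      (fun τ hτ => (diff H hH τ hτ).2.differentiableWithinAt) fun τ hτ => ?_
    obtain ⟨ev, hev⟩ := hH.exists_labelling hTo hτ
    have h := concave₁ hc H hH τ hτ ev hev
    rw [h0 τ hτ, Matrix.mul_zero, Matrix.trace_zero, Complex.zero_re, zero_add] at h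
    refine h.trans (Finset.sum_nonpos fun j _ => mul_nonpos_of_nonpos_of_nonneg ?_ (sq_nonneg _))
    exact (hc.antitoneOn_derivWithin hF).derivWithin_nonpos
  · intro haff H hH τ hτ ev hev
    obtain ⟨h1, h3⟩ := convexOn_and_concaveOn_of_affine hI haff
    exact le_antisymm (concave₁ h3 H hH τ hτ ev hev) (convex₁ h1 H hH τ hτ ev hev)
  · rintro ⟨p, hp, hFp⟩ H hH τ hτ
    -- F'' is affine, hence both convex and concave, and the two opposite inequalities give
    -- equality. The degree-five case below argues likewise with the fourth derivative.
    have haff := exists_affine_iteratedDerivWithin hI (k := 2) hp hFp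
    rw [← h2] at haff
    obtain ⟨h1, h3⟩ := convexOn_and_concaveOn_of_affine hI haff
    exact le_antisymm (convex₂ h1 H hH τ hτ) (concave₂ h3 H hH τ hτ)
  · intro hn _ heq
    -- If I has at most one point, a constant polynomial already agrees with F there.
    rcases I.subsingleton_or_nontrivial with hs | hs
    · rcases hs.eq_empty_or_singleton with rfl | ⟨c, rfl⟩
      · exact ⟨0, by simp, by simp⟩
      · exact ⟨C (F c), by simp, by simp⟩
    refine exists_polynomial_of_trapezoid_eq hI hs hF hf fun x hx y hy => ?_
    have h := eq_zero_of_forall_family hn hTn (I := I) (trapezoidDefect_symm _ _)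
      (trapezoidDefect_self _ _) (fun H hH τ hτ hA => by
        rw [← hH.deriv_deriv_traceFun_sub hTo hF hf hτ hA, heq H hH τ hτ, sub_self]) x hx y hy
    by_cases hxy : x = y
    · subst hxy; simp
    rw [trapezoidDefect] at h
    rw [← mul_dividedDiff_of_ne _ (derivWithin (derivWithin F I) I) hxy, sub_eq_zero.mp h]
  · rintro ⟨p, hp, hFp⟩ H hH τ hτ
    obtain ⟨h1, h3⟩ := convexOn_and_concaveOn_of_affine hI
      (exists_affine_iteratedDerivWithin hI (k := 4) hp hFp)
    have hC : ContDiffOn ℝ 4 F I := by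
      have h5 := (p.contDiff_aeval (𝕜 := ℝ) 4).contDiffOn (s := I)
      exact h5.congr fun x hx => by simp [hFp x hx]
    exact le_antisymm (concave₃ hC h3 H hH τ hτ) (convex₃ hC h1 H hH τ hτ)
  · intro hn hC _ heq
    rcases I.subsingleton_or_nontrivial with hs | hs
    · rcases hs.eq_empty_or_singleton with rfl | ⟨c, rfl⟩
      · exact ⟨0, by simp, by simp⟩
      · exact ⟨C (F c), by simp, by simp⟩
    refine exists_polynomial_of_corrected_trapezoid_eq hI hs (fun k hk =>
      hC.differentiableOn_iteratedDerivWithin (by exact_mod_cast hk)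
        (hI.uniqueDiffOn_of_nontrivial hs)) fun x hx y hy => ?_
    have h := eq_zero_of_forall_family hn hTn (I := I)
      (correctedTrapezoidDefect_symm (derivWithin F I) (derivWithin (derivWithin F I) I)
        (iteratedDerivWithin 4 F I))
      (correctedTrapezoidDefect_self _ _ _) (fun H hH τ hτ hA => by
        rw [← hH.deriv_deriv_traceFun_sub' hTo hF hf hτ hA, heq H hH τ hτ, sub_self]) x hx y hy
    by_cases hxy : x = y
    · subst hxy; simp
    rw [correctedTrapezoidDefect, trapezoidDefect] at h
    rw [iteratedDerivWithin_one, ← h2,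
      ← mul_dividedDiff_of_ne _ (derivWithin (derivWithin F I) I) hxy]
    linear_combination (y - x) * h
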